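/- Let $G$ be a second-countable, unimodular, amenable, non-compact locally compact (Hausdorff) group with Haar measure $\mu$, let $Q\subseteq G$ be a compact symmetric neighbourhood of the identity, and let $(K_n)_{n\in\mathbb N}$ be a strong Følner sequence in $G$, that is, a sequence of compact sets of positive measure such that $$\lim_{n\to\infty}\frac{\mu(K_nC\,\triangle\,K_n)}{\mu(K_n)}=0\quad\text{and}\quad \lim_{n\to\infty}\frac{\mu(K_nC\cap K_n^{c}C)}{\mu(K_n)}=0$$ for every non-empty compact set $C\subseteq G$. Let $(\pi,\mathcal H_\pi)$ be an irreducible projective unitary representation of $G$ on a Hilbert space, i.e. a strongly measurable map $\pi$ from $G$ into the unitary operators with $\pi(xy)=\sigma(x,y)\pi(x)\pi(y)$ for some $\sigma:G\times G\to\mathbb T$, having $\{0\}$ and $\mathcal H_\pi$ as its only closed invariant subspaces. Suppose that $\pi$ is square-integrable, i.e. $\int_G|\langle h,\pi(x)h\rangle|^2\,d\mu(x)<\infty$ for some $h\neq 0$, and let $d_\pi>0$ be its formal degree, i.e. the number with $$\int_G\langle f_1,\pi(x)g_1\rangle\langle\pi(x)g_2,f_2\rangle\,d\mu(x)=d_\pi^{-1}\langle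 f_1,f_2\rangle\overline{\langle g_1,g_2\rangle}\qquad\text{for all } f_1,f_2,g_1,g_2\in\mathcal H_\pi .$$ Let $\mathcal B^2_\pi$ be the set of all $g\in\mathcal H_\pi$ for which $V_gg:x\mapsto\langle g,\pi(x)g\rangle$ is locally essentially bounded and $x\mapsto\operatorname{ess\,sup}_{z\in Q}|V_gg(xz)|$ belongs to $L^2(G)$. For $\Lambda\subseteq G$ put $$D^+(\Lambda)=\limsup_{n\to\infty}\,\sup_{x\in G}\frac{\#(\Lambda\cap xK_n)}{\mu(K_n)} .$$ A family $(v_i)_{i\in I}$ in $\mathcal H_\pi$ is a frame if there are $A,B>0$ with $A\|f\|^2\le\sum_{i\in I}|\langle f,v_i\rangle|^2\le B\|f\|^2$ for all $f\in\mathcal H_\pi$. **Theorem.** Let $\Lambda\subseteq G$ be discrete and $g\in\mathcal B^2_\pi$. If $(\pi(\lambda)g)_{\lambda\in\Lambda}$ is a frame for $\mathcal H_\pi$ and $D^+(\Lambda)>d_\pi$, then there exists an infinite set $\Gamma\subset\Lambda$ such that $(\pi(\lambda)g)_{\lambda\in\Lambda\setminus\Gamma}$ is a frame for $\mathcal H_\pi$.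 -/

import Mathlib

open MeasureTheory Filter Topology Set
open scoped ENNReal Pointwise

noncomputable section

namespace CoherentFrame

/-! ### Følner sequences and Beurling density -/

section Density

variable {G : Type*} [Group G] [TopologicalSpace G] [MeasurableSpace G]

/-- A (right) Følner sequence: non-null compact sets `K n` such that
`μ (K n * C ∆ K n) / μ (K n) → 0` for every nonempty compact set `C`. (For `C = ∅` the quotient
is constantly `1`, so the empty set has to be left out.) -/
structure IsFolnerSeq (μ : Measure G) (K : ℕ → Set G) : Prop where
  isCompact : ∀ n, IsCompact (K n)
  measure_ne_zero : ∀ n, μ (K n) ≠ 0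
  tendsto_symmDiff : ∀ C : Set G, IsCompact C → C.Nonempty →
    Tendsto (fun n => μ (symmDiff (K n * C) (K n)) / μ (K n)) atTop (𝓝 0)

/-- A (right) strong Følner sequence: moreover `μ (K n * C ∩ (K n)ᶜ * C) / μ (K n) → 0` for every
compact set `C`. -/
structure IsStrongFolnerSeq (μ : Measure G) (K : ℕ → Set G) : Prop extends IsFolnerSeq μ K where
  tendsto_boundary : ∀ C : Set G, IsCompact C →
    Tendsto (fun n => μ ((K n * C) ∩ ((K n)ᶜ * C)) / μ (K n)) atTop (𝓝 0)

/-- The upper Beurling density `D⁺(Λ) = lim_n sup_x #(Λ ∩ x K_n) / μ (K_n)` of `Λ` along `K`,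
as an extended nonnegative real. It is written as a `limsup`, which equals the limit whenever
the limit exists. -/
def upperBeurlingDensity (μ : Measure G) (K : ℕ → Set G) (Λ : Set G) : ℝ≥0∞ :=
  limsup (fun n => ⨆ x : G, ((Λ ∩ x • K n).encard : ℝ≥0∞) / μ (K n)) atTop

end Density

/-! ### Local maximal functions and Wiener amalgam spaces -/

section Amalgam

variable {G : Type*} [Group G] [TopologicalSpace G] [MeasurableSpace G]

/-- The (left-sided) local maximal function `M^L F (x) = ess sup_{z ∈ Q} |F (x z)|`. -/
def localMax (μ : Measure G) (Q : Set G) (F : G → ℂ) (x : G) : ℝ≥0∞ :=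
  essSup (fun z => ‖F (x * z)‖ₑ) (μ.restrict Q)

/-- `F ∈ W^L(L^p)`: the function `F` is locally essentially bounded and `M^L F ∈ L^p`. -/
def MemAmalgam (μ : Measure G) (Q : Set G) (p : ℝ≥0∞) (F : G → ℂ) : Prop :=
  (∀ C : Set G, IsCompact C → MemLp F ∞ (μ.restrict C)) ∧ MemLp (localMax μ Q F) p μ

end Amalgam

/-! ### Frames -/

/-- The family `v` is a frame for `H`: there are `A, B > 0` with
`A ‖f‖² ≤ ∑ |⟨f, v i⟩|² ≤ B ‖f‖²` for all `f`. Mathlib's inner product is linear in the second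
argument, so `⟨f, v i⟩` is `inner ℂ (v i) f`. -/
def IsFrame {ι H : Type*} [NormedAddCommGroup H] [InnerProductSpace ℂ H] (v : ι → H) : Prop :=
  ∃ A B : ℝ, 0 < A ∧ 0 < B ∧ ∀ f : H,
    Summable (fun i => ‖inner ℂ (v i) f‖ ^ 2) ∧
    A * ‖f‖ ^ 2 ≤ ∑' i, ‖inner ℂ (v i) f‖ ^ 2 ∧
    ∑' i, ‖inner ℂ (v i) f‖ ^ 2 ≤ B * ‖f‖ ^ 2

/-! ### Projective unitary representations -/

/-- A projective unitary representation of `G` on `H`: a strongly measurable map into the unitary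
operators with `π (x y) = σ (x, y) π x π y` for some function `σ` with values in the circle. -/
structure ProjUnitaryRep (G H : Type*) [Group G] [TopologicalSpace G] [MeasurableSpace G]
    [NormedAddCommGroup H] [InnerProductSpace ℂ H] where
  toFun : G → (H ≃ₗᵢ[ℂ] H)
  stronglyMeasurable' : ∀ f : H, StronglyMeasurable (fun x => toFun x f)
  exists_cocycle' : ∃ σ : G → G → Circle, ∀ x y : G, ∀ f : H,
    toFun (x * y) f = (σ x y : ℂ) • toFun x (toFun y f)

namespace ProjUnitaryRep

variable {G H : Type*} [Group G] [TopologicalSpace G] [MeasurableSpace G]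
  [NormedAddCommGroup H] [InnerProductSpace ℂ H]

instance : CoeFun (ProjUnitaryRep G H) (fun _ => G → (H ≃ₗᵢ[ℂ] H)) := ⟨ProjUnitaryRep.toFun⟩

/-- The coefficient transform `V_g f (x) = ⟨f, π(x) g⟩` (linear in `f`). -/
def coeff (π : ProjUnitaryRep G H) (g f : H) (x : G) : ℂ := inner ℂ (π x g) f

/-- The only closed invariant subspaces are `{0}` and `H`. -/
def IsIrreducible (π : ProjUnitaryRep G H) : Prop :=
  ∀ W : Submodule ℂ H, IsClosed (W : Set H) → (∀ x : G, ∀ f ∈ W, π x f ∈ W) → W = ⊥ ∨ W = ⊤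

/-- A discrete series (irreducible square-integrable) representation. -/
structure IsDiscreteSeries (π : ProjUnitaryRep G H) (μ : Measure G) : Prop where
  irreducible : π.IsIrreducible
  squareIntegrable : ∃ g : H, g ≠ 0 ∧ ∫⁻ x, ‖π.coeff g g x‖ₑ ^ 2 ∂μ < ∞

/-- The orthogonality relations with constant `d`:
`∫ ⟨f₁, π(x) g₁⟩ ⟨π(x) g₂, f₂⟩ dμ(x) = d⁻¹ ⟨f₁, f₂⟩ conj ⟨g₁, g₂⟩` for all `f₁, f₂, g₁, g₂`, with
brackets linear in the first argument. -/
def IsFormalDegree (π : ProjUnitaryRep G H) (μ : Measure G) (d : ℝ) : Prop :=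
  0 < d ∧ ∀ f₁ f₂ g₁ g₂ : H,
    ∫ x, π.coeff g₁ f₁ x * (starRingEnd ℂ) (π.coeff g₂ f₂ x) ∂μ =
      (d : ℂ)⁻¹ * inner ℂ f₂ f₁ * (starRingEnd ℂ) (inner ℂ g₂ g₁)

theorem IsFormalDegree.unique [Nontrivial H] {π : ProjUnitaryRep G H} {μ : Measure G} {d d' : ℝ}
    (h : π.IsFormalDegree μ d) (h' : π.IsFormalDegree μ d') : d = d' := by
  obtain ⟨f, hf⟩ := exists_ne (0 : H)
  have e := (h.2 f f f f).symm.trans (h'.2 f f f f)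
  have hi : inner ℂ f f ≠ 0 := inner_self_ne_zero.mpr hf
  have hi' : (starRingEnd ℂ) (inner ℂ f f) ≠ 0 := by simpa using hi
  have e' := mul_right_cancel₀ hi (mul_right_cancel₀ hi' e)
  exact_mod_cast inv_injective e'

open Classical in
/-- The formal degree `d_π`: the number `d > 0` for which the orthogonality relations hold
(it exists and is unique for a discrete series representation of a unimodular group). -/
def formalDegree (π : ProjUnitaryRep G H) (μ : Measure G) : ℝ :=
  if h : ∃ d : ℝ, π.IsFormalDegree μ d then h.choose else 0

/-- The set `B²_π = {g | V_g g ∈ W^L(L²)}`. -/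
def B2 (π : ProjUnitaryRep G H) (μ : Measure G) (Q : Set G) : Set H :=
  {g | MemAmalgam μ Q 2 (π.coeff g g)}

end ProjUnitaryRep

end CoherentFrame

end

/-! Let `R` be the inverse frame operator. The numbers `p l = ⟨R π(l)g, π(l)g⟩` lie in `[0, 1]`,
and `∑ l, ⟨R π(l)g, w⟩ ⟨w, π(l)g⟩ = ‖w‖²` for all `w`. Put `w = π(x)g` and integrate over
`x ∈ y K C` with `C` a large compact set: by the orthogonality relations and the tail estimate for
`V_g g` in the Wiener amalgam space, the terms with `l ∈ y K` contribute
`d_π⁻¹ ‖g‖² ∑_{l ∈ y K} p l` up to small errors, while the whole sum contributes `‖g‖² μ(K C)`.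
Along the Følner sequence `∑_{l ∈ y K_n} p l` is therefore at most `(d_π + o(1)) μ(K_n)`, up to an
arbitrarily small multiple of the number of points, so `D⁺(Λ) > d_π` forces `p l ≤ α < 1` for
infinitely many `l`.

The Gram matrix of such `π(l)g` with respect to `R` is nearly diagonal along a sparse sequence,
because a Bessel family tends weakly to `0`. The sequence then carries at most a fraction `β < 1`
of the frame sum of every vector, so its removal leaves a frame. -/

namespace CoherentFrame

section Unimodular

variable {G : Type*} [Group G] [TopologicalSpace G] [IsTopologicalGroup G] [LocallyCompactSpace G]
  [SecondCountableTopology G] [MeasurableSpace G] [BorelSpace G]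

theorem isInvInvariant_of_isMulRightInvariant (μ : Measure G) [μ.IsHaarMeasure]
    [μ.IsMulRightInvariant] : μ.IsInvInvariant := by
  have : IsFiniteMeasureOnCompacts μ.inv := ⟨fun K hK => by
    rw [Measure.inv_apply]; exact hK.inv.measure_lt_top⟩
  set c := μ.inv.haarScalarFactor μ
  have hinv : μ.inv = c • μ := Measure.isMulLeftInvariant_eq_smul μ.inv μ
  obtain ⟨K, hK, hK_nhds⟩ := exists_compact_mem_nhds (1 : G)
  set S := K ∪ K⁻¹
  have hS_symm : S⁻¹ = S := by rw [union_inv, inv_inv, union_comm]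
  have hS_zero : μ S ≠ 0 :=
    (Measure.measure_pos_of_mem_nhds μ (mem_of_superset hK_nhds subset_union_left)).ne'
  have hS_top : μ S ≠ ∞ := (hK.union hK.inv).measure_lt_top.ne
  have hc : (1 : ℝ≥0∞) * μ S = c * μ S := calc
    1 * μ S = μ.inv S := by rw [Measure.inv_apply, hS_symm, one_mul]
    _ = c * μ S := by rw [hinv, Measure.smul_apply]; rfl
  have hc_one : c = 1 := by exact_mod_cast ((ENNReal.mul_left_inj hS_zero hS_top).mp hc).symm
  exact ⟨by rw [hinv, hc_one, one_smul]⟩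

end Unimodular

namespace ProjUnitaryRep

section Coeff

variable {G H : Type*} [Group G] [TopologicalSpace G] [MeasurableSpace G]
  [NormedAddCommGroup H] [InnerProductSpace ℂ H] (π : ProjUnitaryRep G H)

theorem stronglyMeasurable_coeff (g f : H) : StronglyMeasurable (π.coeff g f) :=
  (π.stronglyMeasurable' g).inner stronglyMeasurable_const

theorem coeff_map_mul_conj (h₁ h₂ f₁ f₂ : H) (x y : G) :
    π.coeff h₁ (π x f₁) (x * y) * (starRingEnd ℂ) (π.coeff h₂ (π x f₂) (x * y)) =
      π.coeff h₁ f₁ y * (starRingEnd ℂ) (π.coeff h₂ f₂ y) := by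
  obtain ⟨σ, hσ⟩ := π.exists_cocycle'
  have hphase (h f : H) :
      π.coeff h (π x f) (x * y) = (starRingEnd ℂ) (σ x y : ℂ) * π.coeff h f y := by
    rw [coeff, hσ, inner_smul_left, LinearIsometryEquiv.inner_map_map, coeff]
  have hσ_unit : (starRingEnd ℂ) (σ x y : ℂ) * (σ x y : ℂ) = 1 := by
    rw [← Circle.coe_inv_eq_conj, ← Circle.coe_mul, inv_mul_cancel, Circle.coe_one]
  rw [hphase, hphase, map_mul, Complex.conj_conj]
  linear_combination (π.coeff h₁ f₁ y * (starRingEnd ℂ) (π.coeff h₂ f₂ y)) * hσ_unit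

theorem norm_coeff_map (h f : H) (x y : G) : ‖π.coeff h (π x f) y‖ = ‖π.coeff h f (x⁻¹ * y)‖ := by
  obtain ⟨σ, hσ⟩ := π.exists_cocycle'
  conv_lhs => rw [← mul_inv_cancel_left x y, coeff, hσ, inner_smul_left, norm_mul,
    LinearIsometryEquiv.inner_map_map, RCLike.norm_conj, Circle.norm_coe, one_mul]
  rfl

theorem exists_map_inv (x : G) : ∃ c : Circle, ∀ f : H, π x⁻¹ f = (c : ℂ) • (π x).symm f := by
  obtain ⟨σ, hσ⟩ := π.exists_cocycle'
  have hone (f : H) : (σ 1 1 : ℂ) • π 1 f = f := (π 1).injective <| by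
    rw [map_smul, ← hσ, one_mul]
  refine ⟨(σ 1 1 * σ x x⁻¹)⁻¹, fun f => ?_⟩
  apply (π x).injective
  rw [map_smul, LinearIsometryEquiv.apply_symm_apply, Circle.coe_inv,
    eq_inv_smul_iff₀ (Circle.coe_ne_zero _), Circle.coe_mul, mul_smul, ← hσ, mul_inv_cancel, hone]

theorem coeff_inv_mul_conj (g₁ g₂ f₁ f₂ : H) (x : G) :
    π.coeff g₁ f₁ x⁻¹ * (starRingEnd ℂ) (π.coeff g₂ f₂ x⁻¹) =
      (starRingEnd ℂ) (π.coeff f₁ g₁ x) * π.coeff f₂ g₂ x := by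
  obtain ⟨c, hc⟩ := π.exists_map_inv x
  have hphase (g f : H) :
      π.coeff g f x⁻¹ = (starRingEnd ℂ) (c : ℂ) * (starRingEnd ℂ) (π.coeff f g x) := by
    rw [coeff, hc, inner_smul_left, ← (π x).inner_map_map, LinearIsometryEquiv.apply_symm_apply,
      coeff, inner_conj_symm]
  have hc_unit : (starRingEnd ℂ) (c : ℂ) * (c : ℂ) = 1 := by
    rw [← Circle.coe_inv_eq_conj, ← Circle.coe_mul, inv_mul_cancel, Circle.coe_one]
  rw [hphase, hphase, map_mul, Complex.conj_conj, Complex.conj_conj]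
  linear_combination ((starRingEnd ℂ) (π.coeff f₁ g₁ x) * π.coeff f₂ g₂ x) * hc_unit

theorem norm_coeff_inv (g f : H) (x : G) : ‖π.coeff g f x⁻¹‖ = ‖π.coeff f g x‖ := by
  obtain ⟨c, hc⟩ := π.exists_map_inv x
  rw [coeff, hc, inner_smul_left, norm_mul, RCLike.norm_conj, Circle.norm_coe, one_mul,
    ← (π x).inner_map_map, LinearIsometryEquiv.apply_symm_apply, coeff, norm_inner_symm]

end Coeff

/-! ### Intertwiners and the orthogonality relations -/

section Schur

variable {G H : Type*} [Group G] [TopologicalSpace G] [MeasurableSpace G]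
  [NormedAddCommGroup H] [InnerProductSpace ℂ H] {π : ProjUnitaryRep G H}

theorem IsIrreducible.eq_zero_or_injective (hπ : π.IsIrreducible) {T : H →L[ℂ] H}
    (hT : ∀ x f, T (π x f) = π x (T f)) : T = 0 ∨ Function.Injective T := by
  have hinv (x : G) (f : H) (hf : f ∈ T.ker) : π x f ∈ T.ker := by
    rw [LinearMap.mem_ker, ContinuousLinearMap.coe_coe] at hf ⊢
    rw [hT, hf, map_zero]
  rcases hπ T.ker T.isClosed_ker hinv with hker | hker
  · exact Or.inr (LinearMap.ker_eq_bot.mp hker)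
  · exact Or.inl (ContinuousLinearMap.coe_injective (LinearMap.ker_eq_top.mp hker))

variable [CompleteSpace H]

theorem IsIrreducible.le_algebraMap_or_algebraMap_le (hπ : π.IsIrreducible) {R : H →L[ℂ] H}
    (hR : IsSelfAdjoint R) (hcomm : ∀ x f, R (π x f) = π x (R f)) (m : ℝ) :
    R ≤ algebraMap ℝ (H →L[ℂ] H) m ∨ algebraMap ℝ (H →L[ℂ] H) m ≤ R := by
  set S : H →L[ℂ] H := R - algebraMap ℝ (H →L[ℂ] H) m
  have hS : IsSelfAdjoint S := hR.sub (.algebraMap _ (.all m))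
  have hS_comm (x : G) : Commute S ((π x).toContinuousLinearEquiv : H →L[ℂ] H) :=
    .sub_left (ContinuousLinearMap.ext (hcomm x)) (Algebra.commutes m _)
  have hpos_comm (x : G) (f : H) : S⁺ (π x f) = π x (S⁺ f) := by
    have h : Commute S⁺ ((π x).toContinuousLinearEquiv : H →L[ℂ] H) := (hS_comm x).cfcₙ_real _
    exact DFunLike.congr_fun h.eq f
  rcases hπ.eq_zero_or_injective hpos_comm with hpos | hpos
  · exact Or.inl (sub_nonpos.mp ((CFC.posPart_eq_zero_iff S hS).mp hpos))
  · have hneg : S⁻ = 0 := ContinuousLinearMap.ext fun f => hpos <| by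
      rw [zero_apply, map_zero]
      exact DFunLike.congr_fun (CFC.posPart_mul_negPart S) f
    exact Or.inr (sub_nonneg.mp ((CFC.negPart_eq_zero_iff S hS).mp hneg))

theorem IsIrreducible.exists_eq_smul (hπ : π.IsIrreducible) {R : H →L[ℂ] H}
    (hR : IsSelfAdjoint R) (hcomm : ∀ x f, R (π x f) = π x (R f)) : ∃ r : ℝ, R = r • 1 := by
  rcases subsingleton_or_nontrivial H with hH | hH
  · exact ⟨0, ContinuousLinearMap.ext fun f => Subsingleton.elim _ _⟩
  obtain ⟨r, hr⟩ : (spectrum ℝ R).Nonempty := ContinuousFunctionalCalculus.spectrum_nonempty R hR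
  have hle {s t : ℝ} (hs : s ∈ spectrum ℝ R) (ht : t ∈ spectrum ℝ R) : s ≤ t := by
    by_contra! hts
    obtain ⟨m, htm, hms⟩ := exists_between hts
    rcases hπ.le_algebraMap_or_algebraMap_le hR hcomm m with h | h
    · exact (((le_algebraMap_iff_spectrum_le hR).mp h) s hs).not_gt hms
    · exact (((algebraMap_le_iff_le_spectrum hR).mp h) t ht).not_gt htm
  refine ⟨r, ?_⟩
  rw [← Algebra.algebraMap_eq_smul_one]
  exact CFC.eq_algebraMap_of_spectrum_subset_singleton R r
    (fun s hs => le_antisymm (hle hs hr) (hle hr hs)) hR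

theorem IsIrreducible.surjective_of_intertwines {E : Type*} [NormedAddCommGroup E]
    [InnerProductSpace ℂ E] [CompleteSpace E] (hπ : π.IsIrreducible) {ι : E →L[ℂ] H}
    (hι : Function.Injective ι) (hι_ne : ι ≠ 0) {U : G → E → E}
    (hU_inner : ∀ x p q, inner ℂ (U x p) (U x q) = inner ℂ p q)
    (hU : ∀ x p, ι (U x p) = π x (ι p)) :
    Function.Surjective ι ∧ ∃ C : ℝ, ∀ p q, inner ℂ p q = C * inner ℂ (ι p) (ι q) := by
  have hU_surj (x : G) (p : E) : ∃ q, U x q = p := by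
    obtain ⟨c, hc⟩ := π.exists_map_inv x
    refine ⟨(c : ℂ)⁻¹ • U x⁻¹ p, hι ?_⟩
    rw [hU, map_smul, hU, hc, inv_smul_smul₀ (Circle.coe_ne_zero c),
      LinearIsometryEquiv.apply_symm_apply]
  have hadj_map (x : G) (u : H) : ι.adjoint (π x u) = U x (ι.adjoint u) := by
    refine ext_inner_left ℂ fun p => ?_
    obtain ⟨q, rfl⟩ := hU_surj x p
    rw [ι.adjoint_inner_right, hU, LinearIsometryEquiv.inner_map_map, hU_inner,
      ι.adjoint_inner_right]
  obtain ⟨r, hr⟩ : ∃ r : ℝ, ι ∘L ι.adjoint = r • 1 :=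
    hπ.exists_eq_smul ι.isPositive_self_comp_adjoint.isSelfAdjoint fun x u => by
      rw [ContinuousLinearMap.comp_apply, hadj_map, hU, ContinuousLinearMap.comp_apply]
  have happly (u : H) : ι (ι.adjoint u) = (r : ℂ) • u := DFunLike.congr_fun hr u
  have hr_ne : (r : ℂ) ≠ 0 := by
    intro hr_zero
    refine hι_ne (ContinuousLinearMap.adjoint.map_eq_zero_iff.mp ?_)
    exact ContinuousLinearMap.ext fun u => hι <| by
      rw [happly, hr_zero, zero_smul, zero_apply, map_zero]
  refine ⟨fun u => ⟨(r : ℂ)⁻¹ • ι.adjoint u, ?_⟩, r⁻¹, fun p q => ?_⟩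
  · rw [map_smul, happly, inv_smul_smul₀ hr_ne]
  · have hadj_self : ι.adjoint (ι q) = (r : ℂ) • q := hι (by rw [happly, map_smul])
    rw [← ι.adjoint_inner_right, hadj_self, inner_smul_right, Complex.ofReal_inv,
      inv_mul_cancel_left₀ hr_ne]

end Schur

section CoeffGraph

variable {G H : Type*} [Group G] [TopologicalSpace G] [MeasurableSpace G]
  [NormedAddCommGroup H] [InnerProductSpace ℂ H] {π : ProjUnitaryRep G H} {μ : Measure G}

theorem coeff_add_right (h f₁ f₂ : H) : π.coeff h (f₁ + f₂) = π.coeff h f₁ + π.coeff h f₂ :=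
  funext fun _ => inner_add_right _ _ _

theorem coeff_smul_right (h f : H) (c : ℂ) : π.coeff h (c • f) = c • π.coeff h f :=
  funext fun _ => inner_smul_right _ _ _

variable (π μ) in
/-- The graph of the coefficient transform `f ↦ V_h f` on its natural domain
`{f | V_h f ∈ L²}`, which is a closed operator although it need not be bounded a priori. -/
def coeffGraph (h : H) : Submodule ℂ (WithLp 2 (H × Lp ℂ 2 μ)) where
  carrier := {p | p.snd =ᵐ[μ] π.coeff h p.fst}
  add_mem' {p q} hp hq := by
    rw [mem_ofPred_eq, WithLp.add_fst, WithLp.add_snd, coeff_add_right]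
    exact (Lp.coeFn_add _ _).trans (EventuallyEq.add hp hq)
  zero_mem' := (Lp.coeFn_zero ℂ 2 μ).trans (.of_forall fun _ => (inner_zero_right _).symm)
  smul_mem' c p hp := by
    rw [mem_ofPred_eq, WithLp.smul_fst, WithLp.smul_snd, coeff_smul_right]
    exact (Lp.coeFn_smul _ _).trans ((show p.snd =ᵐ[μ] π.coeff h p.fst from hp).const_smul c)

theorem isClosed_coeffGraph (h : H) :
    IsClosed (coeffGraph π μ h : Set (WithLp 2 (H × Lp ℂ 2 μ))) := by
  refine isClosed_of_closure_subset fun p hp => ?_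
  obtain ⟨u, hu, hup⟩ := mem_closure_iff_seq_limit.mp hp
  have hfst : Tendsto (fun n => (u n).fst) atTop (𝓝 p.fst) :=
    ((WithLp.continuous_fst 2 H (Lp ℂ 2 μ)).tendsto p).comp hup
  have hsnd : Tendsto (fun n => (u n).snd) atTop (𝓝 p.snd) :=
    ((WithLp.continuous_snd 2 H (Lp ℂ 2 μ)).tendsto p).comp hup
  obtain ⟨ns, hns, hae⟩ := (tendstoInMeasure_of_tendsto_Lp hsnd).exists_seq_tendsto_ae
  change p.snd =ᵐ[μ] π.coeff h p.fst
  filter_upwards [hae, ae_all_iff.mpr hu] with x hx_lim hx_mem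
  simp only [hx_mem] at hx_lim
  exact tendsto_nhds_unique hx_lim (tendsto_const_nhds.inner (hfst.comp hns.tendsto_atTop))

theorem memLp_coeff_of_mem_coeffGraph {h : H} {p : WithLp 2 (H × Lp ℂ 2 μ)}
    (hp : p ∈ coeffGraph π μ h) : MemLp (π.coeff h p.fst) 2 μ :=
  (memLp_congr_ae hp).mp (Lp.memLp p.snd)

theorem exists_mem_coeffGraph {h f : H} (hf : MemLp (π.coeff h f) 2 μ) :
    ∃ p ∈ coeffGraph π μ h, p.fst = f :=
  ⟨WithLp.toLp 2 (f, hf.toLp _), hf.coeFn_toLp, rfl⟩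

theorem inner_eq_of_mem_coeffGraph {h : H} {p q : WithLp 2 (H × Lp ℂ 2 μ)}
    (hp : p ∈ coeffGraph π μ h) (hq : q ∈ coeffGraph π μ h) :
    inner ℂ p q = inner ℂ p.fst q.fst +
      ∫ x, π.coeff h q.fst x * (starRingEnd ℂ) (π.coeff h p.fst x) ∂μ := by
  rw [WithLp.prod_inner_apply, L2.inner_def]
  congr 1
  refine integral_congr_ae ?_
  filter_upwards [show p.snd =ᵐ[μ] π.coeff h p.fst from hp,
    show q.snd =ᵐ[μ] π.coeff h q.fst from hq] with x hpx hqx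
  rw [← hpx, ← hqx, RCLike.inner_apply]
  rfl

theorem eq_of_mem_coeffGraph {h : H} {p q : WithLp 2 (H × Lp ℂ 2 μ)}
    (hp : p ∈ coeffGraph π μ h) (hq : q ∈ coeffGraph π μ h) (hpq : p.fst = q.fst) : p = q := by
  refine WithLp.ofLp_injective 2 (Prod.ext hpq (Lp.ext ?_))
  have hq' : q.snd =ᵐ[μ] π.coeff h p.fst := by rw [hpq]; exact hq
  exact EventuallyEq.trans hp hq'.symm

section MulInvariant

variable [IsTopologicalGroup G] [BorelSpace G] [μ.IsMulLeftInvariant]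

theorem memLp_coeff_map {h f : H} (x : G) (hf : MemLp (π.coeff h f) 2 μ) :
    MemLp (π.coeff h (π x f)) 2 μ :=
  (hf.comp_measurePreserving (measurePreserving_mul_left μ x⁻¹)).congr_norm
    (π.stronglyMeasurable_coeff _ _).aestronglyMeasurable
    (.of_forall fun y => (π.norm_coeff_map h f x y).symm)

theorem integral_coeff_map_mul_conj (h f₁ f₂ : H) (x : G) :
    ∫ y, π.coeff h (π x f₁) y * (starRingEnd ℂ) (π.coeff h (π x f₂) y) ∂μ =
      ∫ y, π.coeff h f₁ y * (starRingEnd ℂ) (π.coeff h f₂ y) ∂μ := by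
  rw [← integral_mul_left_eq_self _ x]
  simp only [coeff_map_mul_conj]

/-- Translation acts isometrically on the graph of `V_h`, and the projection to `H` intertwines
this action with `π`; Schur's lemma makes that projection a multiple of a unitary. -/
theorem IsIrreducible.exists_integral_coeff_mul_conj [CompleteSpace H] (hπ : π.IsIrreducible)
    {h f₀ : H} (hf₀ : f₀ ≠ 0) (hmem : MemLp (π.coeff h f₀) 2 μ) :
    (∀ f, MemLp (π.coeff h f) 2 μ) ∧ ∃ C : ℝ, ∀ f₁ f₂,
      ∫ x, π.coeff h f₁ x * (starRingEnd ℂ) (π.coeff h f₂ x) ∂μ = C * inner ℂ f₂ f₁ := by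
  have : CompleteSpace (coeffGraph π μ h) := (isClosed_coeffGraph h).completeSpace_coe
  let ι : coeffGraph π μ h →L[ℂ] H :=
    (WithLp.fstL 2 ℂ H (Lp ℂ 2 μ)) ∘L (coeffGraph π μ h).subtypeL
  have hι : Function.Injective ι := fun p q hpq => Subtype.ext (eq_of_mem_coeffGraph p.2 q.2 hpq)
  have hι_ne : ι ≠ 0 := by
    obtain ⟨p, hp, rfl⟩ := exists_mem_coeffGraph hmem
    exact fun hzero => hf₀ (DFunLike.congr_fun hzero ⟨p, hp⟩)
  have hinner (p q : coeffGraph π μ h) : inner ℂ p q = inner ℂ (ι p) (ι q) +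
      ∫ x, π.coeff h (ι q) x * (starRingEnd ℂ) (π.coeff h (ι p) x) ∂μ :=
    inner_eq_of_mem_coeffGraph p.2 q.2
  have hmap (x : G) (p : coeffGraph π μ h) : ∃ q : coeffGraph π μ h, ι q = π x (ι p) := by
    obtain ⟨q, hq, hqp⟩ :=
      exists_mem_coeffGraph (memLp_coeff_map x (memLp_coeff_of_mem_coeffGraph p.2))
    exact ⟨⟨q, hq⟩, hqp⟩
  choose U hU using hmap
  have hU_inner (x : G) (p q : coeffGraph π μ h) : inner ℂ (U x p) (U x q) = inner ℂ p q := by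
    rw [hinner, hinner, hU, hU, LinearIsometryEquiv.inner_map_map, integral_coeff_map_mul_conj]
  obtain ⟨hsurj, C, hC⟩ := hπ.surjective_of_intertwines hι hι_ne hU_inner hU
  refine ⟨fun f => ?_, C - 1, fun f₁ f₂ => ?_⟩
  · obtain ⟨p, rfl⟩ := hsurj f
    exact memLp_coeff_of_mem_coeffGraph p.2
  · obtain ⟨p, rfl⟩ := hsurj f₁
    obtain ⟨q, rfl⟩ := hsurj f₂
    rw [Complex.ofReal_sub, Complex.ofReal_one, sub_one_mul, ← hC, hinner, add_sub_cancel_left]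

end MulInvariant

end CoeffGraph

end ProjUnitaryRep

theorem inner_map_map_eq_mul_inner {E F : Type*} [NormedAddCommGroup E] [InnerProductSpace ℂ E]
    [NormedAddCommGroup F] [InnerProductSpace ℂ F] {T S : E →ₗ[ℂ] F} {c : ℂ}
    (hTS : ∀ x, inner ℂ (T x) (S x) = c * inner ℂ x x) (x y : E) :
    inner ℂ (T x) (S y) = c * inner ℂ x y := by
  have hone := hTS (x + y)
  have hI := hTS (x + Complex.I • y)
  simp only [map_add, map_smul, inner_add_left, inner_add_right, inner_smul_left,
    inner_smul_right, Complex.conj_I, hTS] at hone hI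
  linear_combination (1 / 2) * hone - (Complex.I / 2) * hI +
    ((inner ℂ (T x) (S y) - c * inner ℂ x y) / 2 - (inner ℂ (T y) (S x) - c * inner ℂ y x) / 2) *
      Complex.I_sq

namespace ProjUnitaryRep

section Orthogonality

variable {G H : Type*} [Group G] [TopologicalSpace G] [MeasurableSpace G]
  [NormedAddCommGroup H] [InnerProductSpace ℂ H] {π : ProjUnitaryRep G H} {μ : Measure G}

theorem IsDiscreteSeries.nontrivial (hπ : π.IsDiscreteSeries μ) : Nontrivial H :=
  let ⟨h, hh, _⟩ := hπ.squareIntegrable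
  ⟨h, 0, hh⟩

/-- The orbit of `h` is separable by strong measurability, so at almost every `x` the vector
`π x h` would be orthogonal to it, in particular to itself. -/
theorem exists_not_ae_coeff_eq_zero [NeZero μ] {h : H} (hh : h ≠ 0) :
    ∃ f, ¬ π.coeff h f =ᵐ[μ] 0 := by
  by_contra! hzero
  obtain ⟨c, hc, hrange⟩ := (π.stronglyMeasurable' h).isSeparable_range
  have hae : ∀ᵐ x ∂μ, ∀ u ∈ c, π.coeff h u x = 0 := (ae_ball_iff hc).mpr fun u _ => hzero u
  obtain ⟨x, hx⟩ := hae.exists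
  have hclosed : IsClosed {u : H | π.coeff h u x = 0} :=
    isClosed_eq (continuous_const.inner continuous_id) continuous_const
  have hself : π.coeff h (π x h) x = 0 := closure_minimal hx hclosed (hrange ⟨x, rfl⟩)
  exact hh ((map_eq_zero_iff _ (π x).injective).mp (inner_self_eq_zero.mp hself))

/-- The coefficient transform `V_h` as a linear map into `L²`, when it is everywhere defined. -/
noncomputable def coeffLp {h : H} (hL2 : ∀ f, MemLp (π.coeff h f) 2 μ) : H →ₗ[ℂ] Lp ℂ 2 μ where
  toFun f := (hL2 f).toLp
  map_add' f₁ f₂ := by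
    rw [← MemLp.toLp_add]
    exact MemLp.toLp_congr _ _ (.of_forall fun x => congrFun (coeff_add_right h f₁ f₂) x)
  map_smul' c f := by
    rw [← MemLp.toLp_const_smul]
    exact MemLp.toLp_congr _ _ (.of_forall fun x => congrFun (coeff_smul_right h f c) x)

theorem inner_coeffLp {h₁ h₂ : H} (hL2₁ : ∀ f, MemLp (π.coeff h₁ f) 2 μ)
    (hL2₂ : ∀ f, MemLp (π.coeff h₂ f) 2 μ) (f₁ f₂ : H) :
    inner ℂ (coeffLp hL2₁ f₁) (coeffLp hL2₂ f₂) =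
      ∫ x, π.coeff h₂ f₂ x * (starRingEnd ℂ) (π.coeff h₁ f₁ x) ∂μ := by
  rw [L2.inner_def]
  refine integral_congr_ae ?_
  filter_upwards [(hL2₁ f₁).coeFn_toLp, (hL2₂ f₂).coeFn_toLp] with x hx₁ hx₂
  change inner ℂ ((hL2₁ f₁).toLp _ x) ((hL2₂ f₂).toLp _ x) = _
  rw [hx₁, hx₂, RCLike.inner_apply]

variable [IsTopologicalGroup G] [BorelSpace G]

theorem memLp_coeff_swap [μ.IsInvInvariant] {f g : H} (h : MemLp (π.coeff g f) 2 μ) :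
    MemLp (π.coeff f g) 2 μ :=
  (h.comp_measurePreserving (Measure.measurePreserving_inv μ)).congr_norm
    (π.stronglyMeasurable_coeff _ _).aestronglyMeasurable
    (.of_forall (π.norm_coeff_inv g f))

theorem integral_coeff_mul_conj_swap [μ.IsInvInvariant] (f₁ f₂ g₁ g₂ : H) :
    ∫ x, π.coeff g₁ f₁ x * (starRingEnd ℂ) (π.coeff g₂ f₂ x) ∂μ =
      ∫ x, π.coeff f₂ g₂ x * (starRingEnd ℂ) (π.coeff f₁ g₁ x) ∂μ := by
  rw [← integral_inv_eq_self]
  simp only [coeff_inv_mul_conj, mul_comm]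

variable [CompleteSpace H] [μ.IsMulLeftInvariant] [μ.IsInvInvariant]

theorem IsDiscreteSeries.memLp_coeff (hπ : π.IsDiscreteSeries μ) (g f : H) :
    MemLp (π.coeff g f) 2 μ := by
  obtain ⟨h, hh, hfin⟩ := hπ.squareIntegrable
  have hmem : MemLp (π.coeff h h) 2 μ := by
    refine ⟨(π.stronglyMeasurable_coeff h h).aestronglyMeasurable, ?_⟩
    rw [eLpNorm_lt_top_iff_lintegral_rpow_enorm_lt_top two_ne_zero ENNReal.ofNat_ne_top]
    simpa using hfin
  have hL2 := (hπ.irreducible.exists_integral_coeff_mul_conj hh hmem).1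
  exact (hπ.irreducible.exists_integral_coeff_mul_conj hh (memLp_coeff_swap (hL2 g))).1 f

theorem IsDiscreteSeries.exists_integral_coeff_mul_conj (hπ : π.IsDiscreteSeries μ) :
    ∃ κ : ℝ, ∀ g f₁ f₂, ∫ x, π.coeff g f₁ x * (starRingEnd ℂ) (π.coeff g f₂ x) ∂μ =
      κ * inner ℂ f₂ f₁ * inner ℂ g g := by
  obtain ⟨h, hh, -⟩ := hπ.squareIntegrable
  have hC (g : H) := (hπ.irreducible.exists_integral_coeff_mul_conj hh (hπ.memLp_coeff g h)).2
  choose C hC using hC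
  refine ⟨C h / ‖h‖ ^ 2, fun g f₁ f₂ => ?_⟩
  have hsymm : (C g : ℂ) * inner ℂ h h = C h * inner ℂ g g := by
    rw [← hC, ← hC, integral_coeff_mul_conj_swap]
  have hh_inner : inner ℂ h h ≠ 0 := inner_self_ne_zero.mpr hh
  have hnorm : ((‖h‖ ^ 2 : ℝ) : ℂ) = inner ℂ h h := by
    rw [inner_self_eq_norm_sq_to_K]; exact Complex.ofReal_pow _ _
  rw [hC, Complex.ofReal_div, hnorm]
  field_simp
  linear_combination inner ℂ f₂ f₁ * hsymm

/-- Schur's lemma gives the relations for `g₁ = g₂`; inversion exchanges the roles of the `fᵢ` and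
the `gᵢ`, after which polarisation yields the general case. -/
theorem IsDiscreteSeries.exists_isFormalDegree [NeZero μ] (hπ : π.IsDiscreteSeries μ) :
    ∃ d, π.IsFormalDegree μ d := by
  obtain ⟨κ, hκ⟩ := hπ.exists_integral_coeff_mul_conj
  have hκ_pos : 0 < κ := by
    obtain ⟨h, hh, -⟩ := hπ.squareIntegrable
    obtain ⟨f, hf⟩ := exists_not_ae_coeff_eq_zero (π := π) (μ := μ) hh
    set V := coeffLp (hπ.memLp_coeff h)
    have hV : V f ≠ 0 := fun hzero => hf <|
      (hπ.memLp_coeff h f).coeFn_toLp.symm.trans ((Lp.eq_zero_iff_ae_eq_zero (f := V f)).mp hzero)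
    have hnorm : ‖V f‖ ^ 2 = κ * ‖f‖ ^ 2 * ‖h‖ ^ 2 := by
      have hinner := (inner_coeffLp (hπ.memLp_coeff h) (hπ.memLp_coeff h) f f).trans (hκ h f f)
      simp only [inner_self_eq_norm_sq_to_K] at hinner
      exact Complex.ofReal_injective (by simpa using hinner)
    have hprod : 0 < κ * (‖f‖ ^ 2 * ‖h‖ ^ 2) := by
      rw [← mul_assoc, ← hnorm]; positivity
    exact pos_of_mul_pos_left hprod (by positivity)
  refine ⟨κ⁻¹, inv_pos.mpr hκ_pos, fun f₁ f₂ g₁ g₂ => ?_⟩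
  have hdiag (g : H) : inner ℂ (coeffLp (hπ.memLp_coeff f₁) g) (coeffLp (hπ.memLp_coeff f₂) g) =
      κ * inner ℂ f₂ f₁ * inner ℂ g g := by
    rw [inner_coeffLp, ← integral_coeff_mul_conj_swap, hκ]
  rw [integral_coeff_mul_conj_swap, ← inner_coeffLp (hπ.memLp_coeff f₁) (hπ.memLp_coeff f₂),
    inner_map_map_eq_mul_inner hdiag, Complex.ofReal_inv, inv_inv, inner_conj_symm]

theorem IsDiscreteSeries.isFormalDegree_formalDegree [NeZero μ] (hπ : π.IsDiscreteSeries μ) :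
    π.IsFormalDegree μ (π.formalDegree μ) := by
  rw [formalDegree, dif_pos hπ.exists_isFormalDegree]
  exact hπ.exists_isFormalDegree.choose_spec

end Orthogonality

end ProjUnitaryRep

/-! ### Removing sparse sequences from frames -/

section Frames

variable {ι H : Type*} [NormedAddCommGroup H] [InnerProductSpace ℂ H] {v : ι → H} {B : ℝ}

/-- `v` is a Bessel family with bound `B`: `∑ |⟨f, v i⟩|² ≤ B ‖f‖²` for all `f`, expressed through
the finite partial sums, so that summability is not a separate requirement. -/
structure IsBesselBound (v : ι → H) (B : ℝ) : Prop where
  nonneg : 0 ≤ B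
  sum_le : ∀ (s : Finset ι) (f : H), ∑ i ∈ s, ‖inner ℂ (v i) f‖ ^ 2 ≤ B * ‖f‖ ^ 2

theorem IsFrame.exists_isBesselBound (hv : IsFrame v) : ∃ B, IsBesselBound v B := by
  obtain ⟨_, B, _, hB, hAB⟩ := hv
  exact ⟨B, hB.le, fun s f =>
    ((hAB f).1.sum_le_tsum s fun i _ => sq_nonneg _).trans (hAB f).2.2⟩

theorem IsBesselBound.summable (hv : IsBesselBound v B) (f : H) :
    Summable fun i => ‖inner ℂ (v i) f‖ ^ 2 :=
  summable_of_sum_le (fun _ => sq_nonneg _) (hv.sum_le · f)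

theorem IsBesselBound.tsum_le (hv : IsBesselBound v B) (f : H) :
    ∑' i, ‖inner ℂ (v i) f‖ ^ 2 ≤ B * ‖f‖ ^ 2 :=
  Real.tsum_le_of_sum_le (fun _ => sq_nonneg _) (hv.sum_le · f)

theorem IsBesselBound.tendsto_norm_inner_cofinite (hv : IsBesselBound v B) (f : H) :
    Tendsto (fun i => ‖inner ℂ (v i) f‖) cofinite (𝓝 0) := by
  simpa [Real.sqrt_sq (norm_nonneg _)] using (hv.summable f).tendsto_cofinite_zero.sqrt

/-- The analysis operator `f ↦ (⟨f, v i⟩)ᵢ` of a Bessel family, with values in `ℓ²`. -/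
noncomputable def analysisOperator (hv : IsBesselBound v B) : H →L[ℂ] lp (fun _ : ι => ℂ) 2 :=
  LinearMap.mkContinuous
    { toFun := fun f => ⟨fun i => inner ℂ (v i) f, memℓp_gen (by simpa using hv.summable f)⟩
      map_add' := fun _ _ => lp.ext (funext fun _ => inner_add_right _ _ _)
      map_smul' := fun _ _ => lp.ext (funext fun _ => inner_smul_right _ _ _) }
    √B fun f => by
      refine le_of_sq_le_sq ?_ (by positivity)
      rw [mul_pow, Real.sq_sqrt hv.nonneg]
      refine le_trans (le_of_eq ?_) (hv.tsum_le f)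
      simpa using lp.norm_rpow_eq_tsum (p := 2) (by norm_num)
        (⟨fun i => inner ℂ (v i) f, memℓp_gen (by simpa using hv.summable f)⟩ :
          lp (fun _ : ι => ℂ) 2)

@[simp]
theorem analysisOperator_apply (hv : IsBesselBound v B) (f : H) (i : ι) :
    analysisOperator hv f i = inner ℂ (v i) f := rfl

theorem norm_analysisOperator_sq (hv : IsBesselBound v B) (f : H) :
    ‖analysisOperator hv f‖ ^ 2 = ∑' i, ‖inner ℂ (v i) f‖ ^ 2 := by
  simpa using lp.norm_rpow_eq_tsum (p := 2) (by norm_num) (analysisOperator hv f)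

/-- `R` is the inverse of the frame operator `f ↦ ∑ ⟨f, v i⟩ v i`, characterised by symmetry and
the weak form of the reconstruction formula `f = ∑ ⟨R f, v i⟩ v i`. -/
structure IsInverseFrameOperator (v : ι → H) (R : H →L[ℂ] H) : Prop where
  isSymmetric : (R : H →ₗ[ℂ] H).IsSymmetric
  hasSum : ∀ f f', HasSum (fun i => inner ℂ f (v i) * inner ℂ (v i) (R f')) (inner ℂ f f')

theorem IsFrame.exists_isInverseFrameOperator [CompleteSpace H] (hv : IsFrame v) :
    ∃ R, IsInverseFrameOperator v R := by
  obtain ⟨B, hB⟩ := hv.exists_isBesselBound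
  obtain ⟨A, _, hA, _, hAB⟩ := hv
  set T := analysisOperator hB
  set S : H →L[ℂ] H := T.adjoint ∘L T
  have hS_inner (f f' : H) : inner ℂ (S f) f' = inner ℂ (T f) (T f') :=
    T.adjoint_inner_left f' (T f)
  have hS_symm : (S : H →ₗ[ℂ] H).IsSymmetric := T.isPositive_adjoint_comp_self.isSymmetric
  have hS_lower (f : H) : ‖f‖ ^ 2 * A ≤ ‖inner ℂ (S f) f‖ := calc
    ‖f‖ ^ 2 * A ≤ ∑' i, ‖inner ℂ (v i) f‖ ^ 2 := by rw [mul_comm]; exact (hAB f).2.1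
    _ = ‖inner ℂ (S f) f‖ := by
      rw [hS_inner, inner_self_eq_norm_sq_to_K, ← norm_analysisOperator_sq hB]
      simp [T]
  obtain ⟨S', hS'⟩ := (ContinuousLinearMap.isUnit_of_forall_le_norm_inner_map S
    (c := ⟨A, hA.le⟩) hA hS_lower).exists_right_inv
  have hSS' (f : H) : S (S' f) = f := DFunLike.congr_fun hS' f
  refine ⟨S', fun f f' => ?_, fun f f' => ?_⟩
  · have h := hS_symm (S' f) (S' f')
    simpa only [ContinuousLinearMap.coe_coe, hSS'] using h.symm
  · have h := lp.hasSum_inner (𝕜 := ℂ) (T f) (T (S' f'))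
    rw [← hS_inner, show inner ℂ (S f) (S' f') = inner ℂ f (S (S' f')) from hS_symm f (S' f'),
      hSS'] at h
    simpa only [T, analysisOperator_apply, RCLike.inner_apply, inner_conj_symm, mul_comm] using h

theorem inner_analysisOperator_map {R : H →L[ℂ] H} (hB : IsBesselBound v B)
    (hR : IsInverseFrameOperator v R) (f f' : H) :
    inner ℂ (analysisOperator hB f) (analysisOperator hB (R f')) = inner ℂ f f' := by
  refine (lp.hasSum_inner _ _).unique ?_
  simpa only [analysisOperator_apply, RCLike.inner_apply, inner_conj_symm, mul_comm]
    using hR.hasSum f f'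

theorem norm_analysisOperator_map_sq {R : H →L[ℂ] H} (hB : IsBesselBound v B)
    (hR : IsInverseFrameOperator v R) (f : H) :
    ‖analysisOperator hB (R f)‖ ^ 2 = R.reApplyInnerSelf f := by
  rw [← inner_self_eq_norm_sq (𝕜 := ℂ), inner_analysisOperator_map hB hR]
  rfl

theorem sum_norm_inner_sq_le_of_reApplyInnerSelf_le {R : H →L[ℂ] H} (hB : IsBesselBound v B)
    (hR : IsInverseFrameOperator v R) {κ : Type*} (u : κ → H) (s : Finset κ) {β : ℝ} (hβ : 0 ≤ β)
    (hgram : ∀ a : κ → ℂ, R.reApplyInnerSelf (∑ n ∈ s, a n • u n) ≤ β * ∑ n ∈ s, ‖a n‖ ^ 2)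
    (f : H) : ∑ n ∈ s, ‖inner ℂ (u n) f‖ ^ 2 ≤ β * ∑' i, ‖inner ℂ (v i) f‖ ^ 2 := by
  set w := ∑ n ∈ s, (inner ℂ (u n) f : ℂ) • u n with hw
  set S := ∑ n ∈ s, ‖inner ℂ (u n) f‖ ^ 2
  set T := analysisOperator hB
  have hS : (S : ℂ) = inner ℂ f w := by
    rw [hw, inner_sum, Complex.ofReal_sum]
    refine Finset.sum_congr rfl fun n _ => ?_
    rw [inner_smul_right, ← inner_conj_symm f (u n), Complex.mul_conj,
      Complex.normSq_eq_norm_sq]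
  have hCS : S * S ≤ (β * ‖T f‖ ^ 2) * S := calc
    S * S = ‖inner ℂ (T f) (T (R w))‖ ^ 2 := by
      rw [inner_analysisOperator_map hB hR, ← hS, Complex.norm_real, Real.norm_eq_abs, sq_abs, sq]
    _ ≤ (‖T f‖ * ‖T (R w)‖) ^ 2 := by gcongr; exact norm_inner_le_norm _ _
    _ = ‖T f‖ ^ 2 * R.reApplyInnerSelf w := by rw [mul_pow, norm_analysisOperator_map_sq hB hR]
    _ ≤ ‖T f‖ ^ 2 * (β * S) := by gcongr; exact hgram _
    _ = (β * ‖T f‖ ^ 2) * S := by ring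
  rw [← norm_analysisOperator_sq hB]
  have hS_nonneg : 0 ≤ S := Finset.sum_nonneg fun _ _ => sq_nonneg _
  rcases hS_nonneg.eq_or_lt with hS_zero | hS_pos
  · rw [← hS_zero]; positivity
  · exact le_of_mul_le_mul_right hCS hS_pos

theorem reApplyInnerSelf_sum_smul (R : H →L[ℂ] H) {κ : Type*} (u : κ → H) (s : Finset κ)
    (a : κ → ℂ) : R.reApplyInnerSelf (∑ n ∈ s, a n • u n) =
      ∑ m ∈ s, ∑ n ∈ s, (starRingEnd ℂ (a m) * a n * inner ℂ (R (u m)) (u n)).re := by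
  simp_rw [ContinuousLinearMap.reApplyInnerSelf_apply, map_sum, sum_inner, inner_sum, map_smul,
    inner_smul_left, inner_smul_right, mul_assoc, map_sum, RCLike.re_eq_complex_re]

theorem reApplyInnerSelf_sum_smul_le {R : H →L[ℂ] H} {κ : Type*} {u : κ → H} {s : Finset κ}
    {α δ : ℝ} {c : κ → ℝ} (hdiag : ∀ n, R.reApplyInnerSelf (u n) ≤ α)
    (hoff : Pairwise fun m n => ‖inner ℂ (R (u m)) (u n)‖ ≤ c m * c n)
    (hc : ∑ n ∈ s, c n ^ 2 ≤ δ) (a : κ → ℂ) :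
    R.reApplyInnerSelf (∑ n ∈ s, a n • u n) ≤ (α + δ) * ∑ n ∈ s, ‖a n‖ ^ 2 := by
  classical
  have hterm (m n : κ) : (starRingEnd ℂ (a m) * a n * inner ℂ (R (u m)) (u n)).re ≤
      (if m = n then α * ‖a m‖ ^ 2 else 0) + (c m * ‖a m‖) * (c n * ‖a n‖) := by
    split_ifs with h
    · subst h
      rw [mul_comm (starRingEnd ℂ (a m)), Complex.mul_conj, Complex.re_ofReal_mul,
        Complex.normSq_eq_norm_sq, mul_comm α]
      exact le_add_of_le_of_nonneg (mul_le_mul_of_nonneg_left (hdiag m) (sq_nonneg _))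
        (mul_self_nonneg _)
    · calc (starRingEnd ℂ (a m) * a n * inner ℂ (R (u m)) (u n)).re
          ≤ ‖a m‖ * ‖a n‖ * ‖inner ℂ (R (u m)) (u n)‖ := by
            simpa only [norm_mul, RCLike.norm_conj] using Complex.re_le_norm
              (starRingEnd ℂ (a m) * a n * inner ℂ (R (u m)) (u n))
        _ ≤ ‖a m‖ * ‖a n‖ * (c m * c n) := by gcongr; exact hoff h
        _ = 0 + (c m * ‖a m‖) * (c n * ‖a n‖) := by ring
  calc R.reApplyInnerSelf (∑ n ∈ s, a n • u n)
      ≤ ∑ m ∈ s, ∑ n ∈ s, ((if m = n then α * ‖a m‖ ^ 2 else 0) +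
          (c m * ‖a m‖) * (c n * ‖a n‖)) := by
        rw [reApplyInnerSelf_sum_smul]
        exact Finset.sum_le_sum fun m _ => Finset.sum_le_sum fun n _ => hterm m n
    _ = α * ∑ m ∈ s, ‖a m‖ ^ 2 + (∑ m ∈ s, c m * ‖a m‖) ^ 2 := by
        simp_rw [Finset.sum_add_distrib]
        rw [sq, Finset.sum_mul_sum, Finset.mul_sum]
        congr 1
        exact Finset.sum_congr rfl fun m hm => by rw [Finset.sum_ite_eq, if_pos hm]
    _ ≤ α * ∑ m ∈ s, ‖a m‖ ^ 2 + (∑ m ∈ s, c m ^ 2) * ∑ m ∈ s, ‖a m‖ ^ 2 := by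
        gcongr
        exact Finset.sum_mul_sq_le_sq_mul_sq s c fun m => ‖a m‖
    _ ≤ (α + δ) * ∑ n ∈ s, ‖a n‖ ^ 2 := by
        rw [add_mul]
        gcongr

theorem exists_sparse_sequence {J : Set ι} (hJ : J.Infinite) {P : ι → ι → ℝ}
    (hsymm : ∀ i j, P i j = P j i) (hP : ∀ i, Tendsto (P i) cofinite (𝓝 0)) {c : ℕ → ℝ}
    (hc : ∀ n, 0 < c n) (hanti : Antitone c) :
    ∃ e : ℕ → ι, Function.Injective e ∧ (∀ n, e n ∈ J) ∧
      Pairwise fun m n => P (e m) (e n) ≤ c m * c n := by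
  let a := hJ.natEmbedding
  have hPa (i : ℕ) : Tendsto (fun j => P (a i) (a j)) atTop (𝓝 0) := by
    rw [← Nat.cofinite_eq_atTop]
    exact (hP _).comp (Subtype.val_injective.comp a.injective).tendsto_cofinite
  obtain ⟨φ, -, hφ⟩ := exists_seq_of_forall_finset_exists (fun _ : ℕ => True)
    (fun i j => i < j ∧ ∀ k ≤ i, P (a k) (a j) ≤ c (i + 1) ^ 2) fun s _ => by
      refine (((eventually_all_finset s).mpr fun i _ => (eventually_gt_atTop i).and ?_).exists).imp
        fun j hj => ⟨trivial, hj⟩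
      exact (eventually_all_finite (finite_Iic i)).mpr fun k _ =>
        (hPa k).eventually_le_const (pow_pos (hc _) 2)
  have hmono : StrictMono φ := fun m n h => (hφ m n h).1
  have hlt (m n : ℕ) (h : m < n) : P (a (φ m)) (a (φ n)) ≤ c m * c n := by
    obtain ⟨n, rfl⟩ := Nat.exists_eq_add_one_of_ne_zero (Nat.ne_zero_of_lt h)
    have hn : c (φ n + 1) ≤ c (n + 1) := hanti (Nat.succ_le_succ hmono.le_apply)
    calc P (a (φ m)) (a (φ (n + 1)))
        ≤ c (φ n + 1) ^ 2 :=
          (hφ n (n + 1) n.lt_succ_self).2 _ (hmono.monotone (Nat.lt_succ_iff.mp h))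
      _ ≤ c m * c (n + 1) := by
        rw [sq]
        exact mul_le_mul (hn.trans (hanti h.le)) hn (hc _).le (hc _).le
  refine ⟨fun n => a (φ n), Subtype.val_injective.comp (a.injective.comp hmono.injective),
    fun n => (a (φ n)).2, fun m n h => ?_⟩
  rcases h.lt_or_gt with h | h
  · exact hlt m n h
  · rw [hsymm, mul_comm]
    exact hlt n m h

theorem IsFrame.exists_sparse_gram {R : H →L[ℂ] H} (hv : IsFrame v)
    (hR : (R : H →ₗ[ℂ] H).IsSymmetric) {J : Set ι} (hJ : J.Infinite) {δ : ℝ} (hδ : 0 < δ) :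
    ∃ (e : ℕ → ι) (c : ℕ → ℝ), Function.Injective e ∧ (∀ n, e n ∈ J) ∧
      (∀ s : Finset ℕ, ∑ n ∈ s, c n ^ 2 ≤ δ) ∧
      Pairwise fun m n => ‖inner ℂ (R (v (e m))) (v (e n))‖ ≤ c m * c n := by
  obtain ⟨B, hB⟩ := hv.exists_isBesselBound
  obtain ⟨e, he, heJ, hoff⟩ := exists_sparse_sequence hJ (c := fun n => √(δ / 2 / 2 ^ n))
    (P := fun i j => ‖inner ℂ (R (v i)) (v j)‖)
    (fun i j => by
      rw [← norm_inner_symm]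
      exact congrArg norm (hR (v j) (v i)).symm)
    (fun i => (hB.tendsto_norm_inner_cofinite (R (v i))).congr fun j => norm_inner_symm _ _)
    (fun n => by positivity) (fun m n h => by dsimp only; gcongr; norm_num)
  refine ⟨e, _, he, heJ, fun s => ?_, hoff⟩
  refine (Finset.sum_congr rfl fun n _ => Real.sq_sqrt (by positivity)).trans_le
    (sum_le_hasSum s (fun n _ => by positivity) (hasSum_geometric_two' δ))

theorem IsFrame.compl_range {κ : Type*} (hv : IsFrame v) {e : κ → ι} (he : Function.Injective e)
    {β : ℝ} (hβ : β < 1)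
    (hle : ∀ f, ∑' n, ‖inner ℂ (v (e n)) f‖ ^ 2 ≤ β * ∑' i, ‖inner ℂ (v i) f‖ ^ 2) :
    IsFrame fun i : ((range e)ᶜ : Set ι) => v i := by
  obtain ⟨A, B, hA, hB, hAB⟩ := hv
  refine ⟨(1 - β) * A, B, mul_pos (sub_pos.mpr hβ) hA, hB, fun f => ?_⟩
  obtain ⟨hsum, hlower, hupper⟩ := hAB f
  have hsplit := hsum.tsum_subtype_add_tsum_subtype_compl (range e)
  rw [tsum_range (fun i => ‖inner ℂ (v i) f‖ ^ 2) he] at hsplit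
  refine ⟨hsum.subtype _, ?_, ?_⟩
  · have := mul_le_mul_of_nonneg_left hlower (sub_pos.mpr hβ).le
    linarith [hle f]
  · have : 0 ≤ ∑' n, ‖inner ℂ (v (e n)) f‖ ^ 2 := tsum_nonneg fun n => sq_nonneg _
    linarith

theorem IsFrame.exists_infinite_compl {R : H →L[ℂ] H} (hv : IsFrame v)
    (hR : IsInverseFrameOperator v R) {α : ℝ} (hα : α < 1)
    (hinf : {i | R.reApplyInnerSelf (v i) ≤ α}.Infinite) :
    ∃ Γ : Set ι, Γ.Infinite ∧ IsFrame fun i : (Γᶜ : Set ι) => v i := by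
  obtain ⟨B, hB⟩ := hv.exists_isBesselBound
  have hα_nonneg : 0 ≤ α := by
    obtain ⟨i, hi⟩ := hinf.nonempty
    exact le_trans (by rw [← norm_analysisOperator_map_sq hB hR]; positivity) hi
  obtain ⟨e, c, he, hdiag, hc, hoff⟩ :=
    hv.exists_sparse_gram hR.isSymmetric hinf (half_pos (sub_pos.mpr hα))
  refine ⟨range e, infinite_range_of_injective he, hv.compl_range he (β := α + (1 - α) / 2)
    (by linarith) fun f => Real.tsum_le_of_sum_le (fun _ => sq_nonneg _) fun s => ?_⟩
  exact sum_norm_inner_sq_le_of_reApplyInnerSelf_le hB hR (v ∘ e) s (by linarith)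
    (reApplyInnerSelf_sum_smul_le hdiag hoff (hc s)) f

theorem IsFrame.comp_equiv {κ : Type*} (hv : IsFrame v) (e : κ ≃ ι) : IsFrame (v ∘ e) := by
  obtain ⟨A, B, hA, hB, hAB⟩ := hv
  refine ⟨A, B, hA, hB, fun f => ?_⟩
  have htsum : ∑' k, ‖inner ℂ ((v ∘ e) k) f‖ ^ 2 = ∑' i, ‖inner ℂ (v i) f‖ ^ 2 :=
    e.tsum_eq fun i => ‖inner ℂ (v i) f‖ ^ 2
  exact ⟨(e.summable_iff (f := fun i => ‖inner ℂ (v i) f‖ ^ 2)).mpr (hAB f).1,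
    htsum ▸ (hAB f).2⟩

theorem IsFrame.exists_ne_zero [Nontrivial H] (hv : IsFrame v) : ∃ i, v i ≠ 0 := by
  by_contra! h
  obtain ⟨A, B, hA, _, hAB⟩ := hv
  obtain ⟨f, hf⟩ := exists_ne (0 : H)
  have hle : A * ‖f‖ ^ 2 ≤ 0 := by simpa [h] using (hAB f).2.1
  exact hle.not_gt (by positivity)

theorem IsFrame.diff_image_coe {X : Type*} {Λ : Set X} {u : X → H} {Γ : Set Λ}
    (hu : IsFrame fun l : (Γᶜ : Set Λ) => u l) :
    IsFrame fun l : (Λ \ (↑) '' Γ : Set X) => u l :=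
  let e : (Λ \ (↑) '' Γ : Set X) ≃ (Γᶜ : Set Λ) :=
    { toFun := fun l => ⟨⟨l, l.2.1⟩, fun h => l.2.2 ⟨_, h, rfl⟩⟩
      invFun := fun l => ⟨l, l.1.2, fun ⟨_, hm, hml⟩ => l.2 (Subtype.val_injective hml ▸ hm)⟩
      left_inv := fun _ => rfl
      right_inv := fun _ => rfl }
  hu.comp_equiv e

end Frames

/-! ### Relative separation and amalgam tails -/

section CompactTails

variable {X : Type*} [TopologicalSpace X] [SigmaCompactSpace X] [MeasurableSpace X] {μ : Measure X}

theorem exists_isCompact_setLIntegral_ne_zero {f : X → ℝ≥0∞} (hf : ∫⁻ x, f x ∂μ ≠ 0) :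
    ∃ C : Set X, IsCompact C ∧ ∫⁻ x in C, f x ∂μ ≠ 0 := by
  by_contra! h
  rw [← setLIntegral_univ, ← iUnion_compactCovering] at hf
  refine hf (le_antisymm ((lintegral_iUnion_le _ _).trans ?_) bot_le)
  simp [h _ (isCompact_compactCovering X _)]

theorem exists_isCompact_setLIntegral_compl_le [T2Space X] [BorelSpace X] {f : X → ℝ≥0∞}
    (hf : ∫⁻ x, f x ∂μ ≠ ∞) {ε : ℝ≥0∞} (hε : ε ≠ 0) :
    ∃ C : Set X, IsCompact C ∧ ∫⁻ x in Cᶜ, f x ∂μ ≤ ε := by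
  have hmeas (n : ℕ) : MeasurableSet (compactCovering X n) :=
    (isCompact_compactCovering X n).measurableSet
  have htendsto : Tendsto (fun n => μ.withDensity f (compactCovering X n)ᶜ) atTop (𝓝 0) := by
    have h := tendsto_measure_iInter_atTop (μ := μ.withDensity f)
      (fun n => (hmeas n).compl.nullMeasurableSet)
      (fun _ _ h => compl_subset_compl.mpr (compactCovering_subset X h))
      ⟨0, (measure_mono (subset_univ _)).trans_lt (by
        rwa [withDensity_apply _ .univ, setLIntegral_univ, lt_top_iff_ne_top]) |>.ne⟩
    rwa [← compl_iUnion, iUnion_compactCovering, compl_univ, measure_empty] at h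
  obtain ⟨n, hn⟩ := (htendsto.eventually_le_const hε.bot_lt).exists
  exact ⟨_, isCompact_compactCovering X n, by rwa [← withDensity_apply _ (hmeas n).compl]⟩

end CompactTails

section Separation

variable {G : Type*} [Group G] [TopologicalSpace G] {Λ : Set G}

/-- A set is relatively separated if the number of its points in the translates of a compact set is
uniformly bounded. -/
def IsRelativelySeparated (Λ : Set G) : Prop :=
  ∀ C : Set G, IsCompact C → ∃ N : ℕ, ∀ y : G, (Λ ∩ y • C).encard ≤ N

theorem IsRelativelySeparated.finite_preimage_smul (hΛ : IsRelativelySeparated Λ) {C : Set G}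
    (hC : IsCompact C) (y : G) : ((↑) ⁻¹' (y • C) : Set Λ).Finite := by
  obtain ⟨N, hN⟩ := hΛ C hC
  rw [← Set.finite_image_iff Subtype.val_injective.injOn, Subtype.image_preimage_coe]
  exact finite_of_encard_le_coe (hN y)

theorem IsRelativelySeparated.countable [SigmaCompactSpace G] (hΛ : IsRelativelySeparated Λ) :
    Λ.Countable := by
  rw [← inter_univ Λ, ← iUnion_compactCovering, inter_iUnion]
  refine countable_iUnion fun n => Finite.countable ?_
  obtain ⟨N, hN⟩ := hΛ _ (isCompact_compactCovering G n)
  exact finite_of_encard_le_coe (one_smul G (compactCovering G n) ▸ hN 1)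

end Separation

section Translation

variable {G : Type*} [Group G] [MeasurableSpace G] [MeasurableMul G] {μ : Measure G}
  [μ.IsMulLeftInvariant]

theorem setLIntegral_le_setLIntegral_smul_mul {C D : Set G} (f : G → ℝ≥0∞) {l y : G}
    (hl : l ∈ y • C) :
    ∫⁻ x in D, f x ∂μ ≤ ∫⁻ x in y • (C * D), f (l⁻¹ * x) ∂μ := by
  have hlD : l • D ⊆ y • (C * D) := by
    rw [← smul_mul_assoc, ← singleton_smul]
    exact smul_subset_smul_right (singleton_subset_iff.mpr hl)
  calc ∫⁻ x in D, f x ∂μ = ∫⁻ x in l • D, f (l⁻¹ * x) ∂μ := by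
        have h := (measurePreserving_mul_left μ l).setLIntegral_comp_emb
          (measurableEmbedding_mulLeft l) (fun x => f (l⁻¹ * x)) D
        simp only [inv_mul_cancel_left] at h
        exact h
    _ ≤ ∫⁻ x in y • (C * D), f (l⁻¹ * x) ∂μ := lintegral_mono_set hlD

end Translation

namespace ProjUnitaryRep

section Separation

variable {G H : Type*} [Group G] [TopologicalSpace G] [IsTopologicalGroup G]
  [SigmaCompactSpace G] [MeasurableSpace G] [BorelSpace G]
  [NormedAddCommGroup H] [InnerProductSpace ℂ H] {π : ProjUnitaryRep G H} {μ : Measure G}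
  [μ.IsMulLeftInvariant]

theorem isRelativelySeparated_of_isBesselBound [IsFiniteMeasureOnCompacts μ] {f g : H}
    (hfg : ¬ π.coeff f g =ᵐ[μ] 0) {Λ : Set G} {B : ℝ}
    (hB : IsBesselBound (fun l : Λ => π (l : G) g) B) : IsRelativelySeparated Λ := by
  intro C hC
  have hmeas : Measurable fun x => ‖π.coeff f g x‖ₑ ^ 2 :=
    (π.stronglyMeasurable_coeff f g).measurable.enorm.pow_const 2
  have hne : ∫⁻ x, ‖π.coeff f g x‖ₑ ^ 2 ∂μ ≠ 0 := fun h =>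
    hfg (((lintegral_eq_zero_iff hmeas).mp h).mono fun x hx => by simpa using hx)
  obtain ⟨D, hD, hδ⟩ := exists_isCompact_setLIntegral_ne_zero hne
  set δ := ∫⁻ x in D, ‖π.coeff f g x‖ₑ ^ 2 ∂μ
  set b := ENNReal.ofReal (B * ‖f‖ ^ 2)
  have hsum (y : G) (s : Finset (Λ ∩ y • C : Set G)) : ∑ _l ∈ s, δ ≤ b * μ (C * D) := calc
    ∑ _l ∈ s, δ ≤ ∑ l ∈ s, ∫⁻ x in y • (C * D), ‖π.coeff f g ((l : G)⁻¹ * x)‖ₑ ^ 2 ∂μ :=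
      Finset.sum_le_sum fun l _ => setLIntegral_le_setLIntegral_smul_mul _ l.2.2
    _ = ∫⁻ x in y • (C * D), ∑ l ∈ s, ‖π.coeff f g ((l : G)⁻¹ * x)‖ₑ ^ 2 ∂μ :=
      (lintegral_finsetSum _ fun l _ => hmeas.comp (measurable_const_mul _)).symm
    _ ≤ ∫⁻ _ in y • (C * D), b ∂μ := by
      refine lintegral_mono fun x => ?_
      have hcoeff (l : G) : ‖π.coeff f g (l⁻¹ * x)‖ = ‖inner ℂ (π l g) (π x f)‖ := by
        rw [← norm_coeff_map, coeff, norm_inner_symm]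
      have hbound := hB.sum_le (s.map (embeddingOfSubset _ _ inter_subset_left)) (π x f)
      simp only [Finset.sum_map, embeddingOfSubset_apply_coe, LinearIsometryEquiv.norm_map]
        at hbound
      simp only [← ofReal_norm, hcoeff, ← ENNReal.ofReal_pow (norm_nonneg _)]
      rw [← ENNReal.ofReal_sum_of_nonneg fun l _ => sq_nonneg _]
      exact ENNReal.ofReal_le_ofReal hbound
    _ = b * μ (C * D) := by rw [setLIntegral_const, measure_smul]
  have hfin : b * μ (C * D) ≠ ∞ :=
    ENNReal.mul_ne_top ENNReal.ofReal_ne_top (hC.mul hD).measure_lt_top.ne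
  obtain ⟨N, hN⟩ := ENNReal.exists_nat_gt (ENNReal.div_ne_top hfin hδ)
  refine ⟨N, fun y => ?_⟩
  have hle : ((Λ ∩ y • C).encard : ℝ≥0∞) * δ ≤ b * μ (C * D) := by
    rw [← ENNReal.tsum_set_const]
    exact ENNReal.summable.tsum_le_of_sum_le (hsum y)
  have hlt : ((Λ ∩ y • C).encard : ℝ≥0∞) < (N : ℕ∞) :=
    (ENNReal.le_div_iff_mul_le (.inl hδ) (.inr hfin)).mpr hle |>.trans_lt hN
  exact (ENat.toENNReal_lt.mp hlt).le

end Separation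

end ProjUnitaryRep

theorem sum_setLIntegral_le_mul_setLIntegral {X ι : Type*} [MeasurableSpace X] {μ : Measure X}
    {m : X → ℝ≥0∞} (hm : Measurable m) {s : Finset ι} {A : ι → Set X} {E : Set X}
    (hA : ∀ i ∈ s, MeasurableSet (A i)) (hAE : ∀ i ∈ s, A i ⊆ E) {N : ℕ}
    (hN : ∀ z, {i | i ∈ s ∧ z ∈ A i}.encard ≤ N) :
    ∑ i ∈ s, ∫⁻ z in A i, m z ∂μ ≤ N * ∫⁻ z in E, m z ∂μ := by
  classical
  calc ∑ i ∈ s, ∫⁻ z in A i, m z ∂μ = ∑ i ∈ s, ∫⁻ z in E, (A i).indicator m z ∂μ :=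
        Finset.sum_congr rfl fun i hi => by
          rw [setLIntegral_indicator (hA i hi), inter_eq_left.mpr (hAE i hi)]
    _ = ∫⁻ z in E, ∑ i ∈ s, (A i).indicator m z ∂μ :=
        (lintegral_finsetSum' _ fun i hi => (hm.indicator (hA i hi)).aemeasurable).symm
    _ ≤ ∫⁻ z in E, N * m z ∂μ := lintegral_mono fun z => by
        have hcard : (s.filter (z ∈ A ·)).card ≤ N := by
          simpa only [← Finset.coe_filter, encard_coe_eq_coe_finsetCard, Nat.cast_le] using hN z
        simp only [indicator_apply]
        rw [← Finset.sum_filter, Finset.sum_const, nsmul_eq_mul]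
        gcongr
    _ = N * ∫⁻ z in E, m z ∂μ := lintegral_const_mul _ hm

theorem encard_translate_mem_le {G : Type*} [Group G] {Q Λ : Set G} {N : ℕ}
    (hN : ∀ y : G, (Λ ∩ y • Q).encard ≤ N) (s : Finset Λ) (x z : G) :
    {l | l ∈ s ∧ z ∈ (x⁻¹ * l : G) • Q⁻¹}.encard ≤ N := by
  rw [← Subtype.val_injective.encard_image]
  refine (encard_le_encard ?_).trans (hN (x * z))
  rintro _ ⟨l, ⟨-, hl⟩, rfl⟩
  refine ⟨l.2, ?_⟩
  rw [mem_smul_set_iff_inv_smul_mem] at hl ⊢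
  simpa [mul_assoc] using hl

section Amalgam

variable {G : Type*} [Group G] [TopologicalSpace G] [IsTopologicalGroup G]
  [SecondCountableTopology G] [MeasurableSpace G] [BorelSpace G] {μ : Measure G}
  {Q : Set G} {F : G → ℂ}

theorem MemAmalgam.exists_le_lintegral_translate [SFinite μ] [μ.IsMulLeftInvariant]
    [μ.IsInvInvariant] (hF : Measurable F) (hFQ : MemAmalgam μ Q 2 F) :
    ∃ m : G → ℝ≥0∞, Measurable m ∧ ∫⁻ z, m z ∂μ ≠ ∞ ∧
      ∀ᵐ w ∂μ, μ Q * ‖F w‖ₑ ^ 2 ≤ ∫⁻ z in w • Q⁻¹, m z ∂μ := by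
  obtain ⟨hM, hM2⟩ := hFQ.2
  set M := hM.aemeasurable.mk
  have hMmeas : Measurable M := hM.aemeasurable.measurable_mk
  have hMae : localMax μ Q F =ᵐ[μ] M := hM.aemeasurable.ae_eq_mk
  have hint : ∫⁻ z, M z ^ 2 ∂μ ≠ ∞ := by
    rw [eLpNorm_congr_ae hMae, eLpNorm_lt_top_iff_lintegral_rpow_enorm_lt_top (by norm_num)
      (by norm_num)] at hM2
    simpa using hM2.ne
  have hle_mul : ∀ᵐ z ∂μ, ∀ᵐ q ∂μ.restrict Q, ‖F (z * q)‖ₑ ≤ M z := hMae.mono fun z hz =>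
    hz ▸ ENNReal.ae_le_essSup fun q => ‖F (z * q)‖ₑ
  have hle_translate : ∀ᵐ q ∂μ.restrict Q, ∀ᵐ w ∂μ, ‖F w‖ₑ ≤ M (w * q⁻¹) := by
    rw [Measure.ae_ae_comm (p := fun z q => ‖F (z * q)‖ₑ ≤ M z)
      (measurableSet_le (hF.comp measurable_mul).enorm (hMmeas.comp measurable_fst))] at hle_mul
    filter_upwards [hle_mul] with q hq
    simpa using (quasiMeasurePreserving_mul_right μ q⁻¹).ae hq
  rw [Measure.ae_ae_comm (p := fun q w => ‖F w‖ₑ ≤ M (w * q⁻¹))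
    (measurableSet_le (hF.comp measurable_snd).enorm
      (hMmeas.comp (measurable_snd.mul measurable_fst.inv)))] at hle_translate
  refine ⟨fun z => M z ^ 2, hMmeas.pow_const 2, hint, hle_translate.mono fun w hw => ?_⟩
  calc μ Q * ‖F w‖ₑ ^ 2 = ∫⁻ _ in Q, ‖F w‖ₑ ^ 2 ∂μ := by rw [setLIntegral_const, mul_comm]
    _ ≤ ∫⁻ q in Q, M (w / q) ^ 2 ∂μ := lintegral_mono_ae <| hw.mono fun q hq => by
        rw [div_eq_mul_inv]
        gcongr
    _ = ∫⁻ z in w • Q⁻¹, M z ^ 2 ∂μ := by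
        have h := (Measure.measurePreserving_div_left μ w).setLIntegral_comp_emb
          (MeasurableEquiv.divLeft w).measurableEmbedding (fun z => M z ^ 2) Q
        simpa only [← image_inv_eq_inv, ← image_smul, image_image, smul_eq_mul, ← div_eq_mul_inv]
          using h

/-- Averaging over `Q⁻¹` turns the sum over `l ∉ x C Q` into an integral of `m` over `Cᶜ`, up to
the multiplicity `N`. -/
theorem MemAmalgam.exists_isCompact_tail_le [T2Space G] [LocallyCompactSpace G] [SFinite μ]
    [μ.IsMulLeftInvariant] [μ.IsInvInvariant] [IsFiniteMeasureOnCompacts μ]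
    (hQ : IsCompact Q) (hQ_ne_zero : μ Q ≠ 0) (hF : Measurable F) (hFQ : MemAmalgam μ Q 2 F)
    {Λ : Set G} (hΛ : IsRelativelySeparated Λ) {η : ℝ} (hη : 0 < η) :
    ∃ C : Set G, IsCompact C ∧ ∀ᵐ x ∂μ, ∀ s : Finset Λ, (∀ l ∈ s, (l : G) ∉ x • C) →
      ∑ l ∈ s, ‖F (x⁻¹ * l)‖ ^ 2 ≤ η := by
  have := hΛ.countable.to_subtype
  obtain ⟨m, hm, hm_int, hm_le⟩ := hFQ.exists_le_lintegral_translate hF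
  obtain ⟨N, hN⟩ := hΛ Q hQ
  set δ : ℝ≥0∞ := μ Q * ENNReal.ofReal η / (N + 1)
  have hδ : δ ≠ 0 := by simp [δ, hQ_ne_zero, hη]
  obtain ⟨C, hC, hCδ⟩ := exists_isCompact_setLIntegral_compl_le hm_int hδ
  have hgood : ∀ᵐ x ∂μ, ∀ l : Λ,
      μ Q * ‖F (x⁻¹ * l)‖ₑ ^ 2 ≤ ∫⁻ z in (x⁻¹ * l : G) • Q⁻¹, m z ∂μ :=
    ae_all_iff.mpr fun l => (Measure.measurePreserving_inv μ).quasiMeasurePreserving.ae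
      ((quasiMeasurePreserving_mul_right μ (l : G)).ae hm_le)
  refine ⟨C * Q, hC.mul hQ, hgood.mono fun x hx s hs => ?_⟩
  have hdisj (l) (hl : l ∈ s) : (x⁻¹ * l : G) • Q⁻¹ ⊆ Cᶜ := by
    rintro _ ⟨q, hq, rfl⟩ hC'
    refine hs l hl ⟨_, Set.mul_mem_mul hC' hq, ?_⟩
    simp
  have hle : μ Q * ENNReal.ofReal (∑ l ∈ s, ‖F (x⁻¹ * l)‖ ^ 2) ≤ μ Q * ENNReal.ofReal η := calc
    μ Q * ENNReal.ofReal (∑ l ∈ s, ‖F (x⁻¹ * l)‖ ^ 2) = ∑ l ∈ s, μ Q * ‖F (x⁻¹ * l)‖ₑ ^ 2 := by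
      rw [ENNReal.ofReal_sum_of_nonneg fun l _ => sq_nonneg _, Finset.mul_sum]
      simp only [ENNReal.ofReal_pow (norm_nonneg _), ofReal_norm]
    _ ≤ ∑ l ∈ s, ∫⁻ z in (x⁻¹ * l : G) • Q⁻¹, m z ∂μ := Finset.sum_le_sum fun l _ => hx l
    _ ≤ N * ∫⁻ z in Cᶜ, m z ∂μ := sum_setLIntegral_le_mul_setLIntegral hm
      (fun l _ => (hQ.inv.smul _).measurableSet) hdisj (encard_translate_mem_le hN s x)
    _ ≤ (N + 1) * δ := by
      gcongr
      exact le_self_add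
    _ = μ Q * ENNReal.ofReal η := ENNReal.mul_div_cancel (by simp) (by finiteness)
  rwa [ENNReal.mul_le_mul_iff_right hQ_ne_zero hQ.measure_ne_top,
    ENNReal.ofReal_le_ofReal_iff hη.le] at hle

end Amalgam

/-! ### The trace estimate -/

theorem integral_norm_mul_norm_le_sqrt_mul_sqrt {X E F : Type*} [MeasurableSpace X] {μ : Measure X}
    [NormedAddCommGroup E] [NormedAddCommGroup F] {f : X → E} {g : X → F} (hf : MemLp f 2 μ)
    (hg : MemLp g 2 μ) :
    ∫ x, ‖f x‖ * ‖g x‖ ∂μ ≤ √(∫ x, ‖f x‖ ^ 2 ∂μ) * √(∫ x, ‖g x‖ ^ 2 ∂μ) := by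
  simpa [Real.sqrt_eq_rpow] using integral_mul_le_Lp_mul_Lq_of_nonneg Real.HolderConjugate.two_two
    (.of_forall fun x => norm_nonneg (f x)) (.of_forall fun x => norm_nonneg (g x))
    (by simpa using hf.norm) (by simpa using hg.norm)

section CrossTerm

variable {ι H : Type*} [NormedAddCommGroup H] [InnerProductSpace ℂ H] {v : ι → H} {B : ℝ}
  {R : H →L[ℂ] H}

/-- The diagonal entry at `w` of the rank-one operator `f ↦ ⟨R f, u⟩ u`, that is, the contribution
of the vector `u` of a frame with inverse frame operator `R` to the reconstruction of `‖w‖²`. -/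
noncomputable def crossTerm (R : H →L[ℂ] H) (u w : H) : ℝ := (inner ℂ w u * inner ℂ u (R w)).re

theorem abs_crossTerm_le (u w : H) : |crossTerm R u w| ≤ ‖inner ℂ u w‖ * ‖inner ℂ u (R w)‖ := by
  rw [norm_inner_symm u w, ← norm_mul]
  exact Complex.abs_re_le_norm _

theorem IsInverseFrameOperator.hasSum_crossTerm (hR : IsInverseFrameOperator v R) (w : H) :
    HasSum (fun i => crossTerm R (v i) w) (‖w‖ ^ 2) := by
  have h := Complex.hasSum_re (hR.hasSum w w)
  rwa [← RCLike.re_eq_complex_re, inner_self_eq_norm_sq] at h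

theorem IsBesselBound.sum_abs_crossTerm_le (hB : IsBesselBound v B) (s : Finset ι) (w : H) :
    ∑ i ∈ s, |crossTerm R (v i) w| ≤
      √(∑ i ∈ s, ‖inner ℂ (v i) w‖ ^ 2) * (√B * (‖R‖ * ‖w‖)) := calc
  ∑ i ∈ s, |crossTerm R (v i) w| ≤ ∑ i ∈ s, ‖inner ℂ (v i) w‖ * ‖inner ℂ (v i) (R w)‖ :=
    Finset.sum_le_sum fun i _ => abs_crossTerm_le _ _
  _ ≤ √(∑ i ∈ s, ‖inner ℂ (v i) w‖ ^ 2) * √(∑ i ∈ s, ‖inner ℂ (v i) (R w)‖ ^ 2) :=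
    Real.sum_mul_le_sqrt_mul_sqrt _ _ _
  _ ≤ √(∑ i ∈ s, ‖inner ℂ (v i) w‖ ^ 2) * (√B * (‖R‖ * ‖w‖)) := by
    gcongr
    refine Real.sqrt_le_iff.mpr ⟨by positivity, (hB.sum_le s _).trans ?_⟩
    rw [mul_pow, Real.sq_sqrt hB.nonneg]
    gcongr
    · exact hB.nonneg
    · exact R.le_opNorm w

theorem IsBesselBound.sum_crossTerm_le (hB : IsBesselBound v B) (s : Finset ι) (w : H) :
    ∑ i ∈ s, crossTerm R (v i) w ≤ B * ‖R‖ * ‖w‖ ^ 2 := calc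
  ∑ i ∈ s, crossTerm R (v i) w ≤ ∑ i ∈ s, |crossTerm R (v i) w| :=
    Finset.sum_le_sum fun i _ => le_abs_self _
  _ ≤ √(B * ‖w‖ ^ 2) * (√B * (‖R‖ * ‖w‖)) := by
    grw [hB.sum_abs_crossTerm_le, hB.sum_le]
  _ = B * ‖R‖ * ‖w‖ ^ 2 := by
    rw [Real.sqrt_mul hB.nonneg, Real.sqrt_sq (norm_nonneg w)]
    linear_combination ‖R‖ * ‖w‖ ^ 2 * Real.mul_self_sqrt hB.nonneg

theorem IsInverseFrameOperator.sum_crossTerm_le (hB : IsBesselBound v B)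
    (hR : IsInverseFrameOperator v R) {w : H} {F : Finset ι} {η : ℝ}
    (hη : ∀ s : Finset ι, Disjoint s F → ∑ i ∈ s, ‖inner ℂ (v i) w‖ ^ 2 ≤ η) :
    ∑ i ∈ F, crossTerm R (v i) w ≤ ‖w‖ ^ 2 + √η * (√B * (‖R‖ * ‖w‖)) := by
  classical
  rw [← sub_le_iff_le_add]
  refine ge_of_tendsto (hR.hasSum_crossTerm w) ((eventually_ge_atTop F).mono fun F' hF' => ?_)
  have htail : -∑ i ∈ F' \ F, crossTerm R (v i) w ≤ √η * (√B * (‖R‖ * ‖w‖)) := calc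
    -∑ i ∈ F' \ F, crossTerm R (v i) w ≤ ∑ i ∈ F' \ F, |crossTerm R (v i) w| :=
      (neg_le_abs _).trans (Finset.abs_sum_le_sum_abs _ _)
    _ ≤ √η * (√B * (‖R‖ * ‖w‖)) := by
      grw [hB.sum_abs_crossTerm_le, hη _ Finset.sdiff_disjoint]
  linarith [Finset.sum_sdiff (f := fun i => crossTerm R (v i) w) hF']

end CrossTerm

namespace ProjUnitaryRep

section FormalDegree

variable {G H : Type*} [Group G] [TopologicalSpace G] [MeasurableSpace G]
  [NormedAddCommGroup H] [InnerProductSpace ℂ H] {π : ProjUnitaryRep G H} {μ : Measure G} {d : ℝ}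
  {g : H} {R : H →L[ℂ] H}

theorem IsFormalDegree.integral_norm_coeff_sq (hd : π.IsFormalDegree μ d) (g f : H) :
    ∫ x, ‖π.coeff g f x‖ ^ 2 ∂μ = d⁻¹ * ‖f‖ ^ 2 * ‖g‖ ^ 2 := by
  have h := hd.2 f f g g
  simp_rw [Complex.mul_conj, Complex.normSq_eq_norm_sq, integral_complex_ofReal] at h
  exact Complex.ofReal_injective (by simpa using h)

theorem IsFormalDegree.memLp_coeff (hd : π.IsFormalDegree μ d) (g f : H) :
    MemLp (π.coeff g f) 2 μ := by
  by_cases hfg : ‖f‖ ^ 2 * ‖g‖ ^ 2 = 0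
  · have hzero : π.coeff g f = 0 := funext fun x => by
      rcases (by simpa using hfg : f = 0 ∨ g = 0) with rfl | rfl <;> simp [coeff]
    exact hzero ▸ MemLp.zero
  · have hmeas := (π.stronglyMeasurable_coeff g f).aestronglyMeasurable (μ := μ)
    refine (memLp_two_iff_integrable_sq_norm hmeas).mpr (.of_integral_ne_zero ?_)
    rw [hd.integral_norm_coeff_sq, mul_assoc]
    exact mul_ne_zero (inv_ne_zero hd.1.ne') hfg

theorem IsFormalDegree.not_ae_coeff_self_eq_zero (hd : π.IsFormalDegree μ d) (hg : g ≠ 0) :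
    ¬ π.coeff g g =ᵐ[μ] 0 := fun h => by
  have hint := hd.integral_norm_coeff_sq g g
  rw [integral_eq_zero_of_ae (h.mono fun x hx => by simp [hx])] at hint
  have hpos : 0 < d⁻¹ * ‖g‖ ^ 2 * ‖g‖ ^ 2 :=
    mul_pos (mul_pos (inv_pos.mpr hd.1) (by positivity)) (by positivity)
  simp [← hint] at hpos

theorem IsFormalDegree.integrable_norm_coeff_sq (hd : π.IsFormalDegree μ d) (g f : H) :
    Integrable (fun x => ‖π.coeff g f x‖ ^ 2) μ :=
  (hd.memLp_coeff g f).integrable_norm_pow two_ne_zero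

theorem crossTerm_map_eq (hR : (R : H →ₗ[ℂ] H).IsSymmetric) (u : H) (x : G) :
    crossTerm R u (π x g) = (π.coeff g u x * (starRingEnd ℂ) (π.coeff g (R u) x)).re := by
  rw [crossTerm, coeff, coeff, inner_conj_symm, show inner ℂ (R u) (π x g) = _ from hR u (π x g)]
  rfl

theorem IsFormalDegree.integrable_coeff_mul_conj (hd : π.IsFormalDegree μ d) (g f₁ f₂ : H) :
    Integrable (fun x => π.coeff g f₁ x * (starRingEnd ℂ) (π.coeff g f₂ x)) μ :=
  (hd.memLp_coeff g f₁).integrable_mul (hd.memLp_coeff g f₂).star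

theorem IsFormalDegree.integrable_crossTerm (hd : π.IsFormalDegree μ d)
    (hR : (R : H →ₗ[ℂ] H).IsSymmetric) (u : H) :
    Integrable (fun x => crossTerm R u (π x g)) μ := by
  simp only [crossTerm_map_eq hR]
  exact (hd.integrable_coeff_mul_conj g u (R u)).re

theorem IsFormalDegree.integral_crossTerm (hd : π.IsFormalDegree μ d)
    (hR : (R : H →ₗ[ℂ] H).IsSymmetric) (u : H) :
    ∫ x, crossTerm R u (π x g) ∂μ = d⁻¹ * ‖g‖ ^ 2 * R.reApplyInnerSelf u := by
  have h := integral_re (hd.integrable_coeff_mul_conj g u (R u))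
  simp only [RCLike.re_eq_complex_re, ← crossTerm_map_eq hR] at h
  rw [h, hd.2, R.reApplyInnerSelf_apply, RCLike.re_eq_complex_re, inner_self_eq_norm_sq_to_K,
    mul_right_comm, ← Complex.re_ofReal_mul]
  simp

section Localization

variable [IsTopologicalGroup G] [BorelSpace G] [μ.IsMulLeftInvariant]

theorem IsFormalDegree.setIntegral_compl_norm_coeff_sq_le (hd : π.IsFormalDegree μ d)
    {C E : Set G} {l : G} (hlE : l • C ⊆ E) :
    ∫ x in Eᶜ, ‖π.coeff g (π l g) x‖ ^ 2 ∂μ ≤ ∫ x in Cᶜ, ‖π.coeff g g x‖ ^ 2 ∂μ := calc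
  ∫ x in Eᶜ, ‖π.coeff g (π l g) x‖ ^ 2 ∂μ ≤ ∫ x in (l • C)ᶜ, ‖π.coeff g (π l g) x‖ ^ 2 ∂μ :=
    setIntegral_mono_set (hd.integrable_norm_coeff_sq g _).integrableOn
      (.of_forall fun x => sq_nonneg _) (compl_subset_compl.mpr hlE).eventuallyLE
  _ = ∫ x in Cᶜ, ‖π.coeff g (π l g) (l * x)‖ ^ 2 ∂μ := by
    rw [← smul_set_compl, ← image_smul]
    exact (measurePreserving_mul_left μ l).setIntegral_image_emb
      (measurableEmbedding_mulLeft l) _ _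
  _ = ∫ x in Cᶜ, ‖π.coeff g g x‖ ^ 2 ∂μ := by simp only [norm_coeff_map, inv_mul_cancel_left]

/-- The coherent state `π l g` lives near `l`, hence its contribution to the trace is captured by
any set `E ⊇ l C`. -/
theorem IsFormalDegree.reApplyInnerSelf_le_setIntegral_crossTerm (hd : π.IsFormalDegree μ d)
    (hR : (R : H →ₗ[ℂ] H).IsSymmetric) {C E : Set G} (hE : MeasurableSet E)
    {l : G} (hlE : l • C ⊆ E) :
    d⁻¹ * ‖g‖ ^ 2 * R.reApplyInnerSelf (π l g) ≤ ∫ x in E, crossTerm R (π l g) (π x g) ∂μ +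
      √(∫ x in Cᶜ, ‖π.coeff g g x‖ ^ 2 ∂μ) * (√d⁻¹ * (‖R‖ * ‖g‖ ^ 2)) := by
  have hint := hd.integrable_crossTerm (g := g) hR (π l g)
  rw [← hd.integral_crossTerm hR, ← integral_add_compl hE hint]
  gcongr
  have hmem (f : H) : MemLp (π.coeff g f) 2 (μ.restrict Eᶜ) := (hd.memLp_coeff g f).restrict _
  have htotal : ∫ x in Eᶜ, ‖π.coeff g (R (π l g)) x‖ ^ 2 ∂μ ≤ (√d⁻¹ * (‖R‖ * ‖g‖ ^ 2)) ^ 2 := calc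
    ∫ x in Eᶜ, ‖π.coeff g (R (π l g)) x‖ ^ 2 ∂μ ≤ ∫ x, ‖π.coeff g (R (π l g)) x‖ ^ 2 ∂μ :=
      setIntegral_le_integral (hd.integrable_norm_coeff_sq g _) (.of_forall fun x => sq_nonneg _)
    _ = d⁻¹ * ‖R (π l g)‖ ^ 2 * ‖g‖ ^ 2 := hd.integral_norm_coeff_sq _ _
    _ ≤ d⁻¹ * (‖R‖ * ‖g‖) ^ 2 * ‖g‖ ^ 2 := by
      have := hd.1
      gcongr
      simpa using R.le_opNorm (π l g)
    _ = (√d⁻¹ * (‖R‖ * ‖g‖ ^ 2)) ^ 2 := by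
      rw [mul_pow √_, Real.sq_sqrt (inv_pos.mpr hd.1).le]
      ring
  calc ∫ x in Eᶜ, crossTerm R (π l g) (π x g) ∂μ
      ≤ ∫ x in Eᶜ, ‖π.coeff g (π l g) x‖ * ‖π.coeff g (R (π l g)) x‖ ∂μ := by
        refine integral_mono hint.integrableOn ((hmem _).norm.integrable_mul (hmem _).norm)
          fun x => ?_
        rw [crossTerm_map_eq hR]
        simpa only [norm_mul, RCLike.norm_conj] using Complex.re_le_norm
          (π.coeff g (π l g) x * (starRingEnd ℂ) (π.coeff g (R (π l g)) x))
    _ ≤ √(∫ x in Eᶜ, ‖π.coeff g (π l g) x‖ ^ 2 ∂μ) *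
          √(∫ x in Eᶜ, ‖π.coeff g (R (π l g)) x‖ ^ 2 ∂μ) :=
        integral_norm_mul_norm_le_sqrt_mul_sqrt (hmem _) (hmem _)
    _ ≤ _ := by
        gcongr
        · exact hd.setIntegral_compl_norm_coeff_sq_le hlE
        · exact Real.sqrt_le_iff.mpr ⟨by positivity, htotal⟩

end Localization

end FormalDegree

end ProjUnitaryRep

theorem notMem_smul_of_notMem_compl_mul {G : Type*} [Group G] {C K : Set G} {x y l : G}
    (hx : x ∉ y • (Kᶜ * C⁻¹)) (hl : l ∉ y • K) : l ∉ x • C := by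
  rintro ⟨c, hc, rfl⟩
  refine hx ⟨y⁻¹ * (x * c) * c⁻¹, Set.mul_mem_mul (fun hK => hl ⟨_, hK, ?_⟩)
    (Set.inv_mem_inv.mpr hc), ?_⟩ <;> simp [mul_assoc]

theorem setIntegral_le_of_le_add_indicator {X : Type*} [MeasurableSpace X] {μ : Measure X}
    {f : X → ℝ} {D E : Set X} {a b : ℝ} (hD : MeasurableSet D) (hE : MeasurableSet E)
    (hDE : D ⊆ E) (hE_fin : μ E ≠ ∞) (hf : IntegrableOn f E μ)
    (hle : ∀ᵐ x ∂μ, x ∈ E → f x ≤ a + D.indicator (fun _ => b) x) :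
    ∫ x in E, f x ∂μ ≤ a * μ.real E + b * μ.real D := by
  have hconst : IntegrableOn (fun _ => a) E μ := integrableOn_const hE_fin
  have hind : IntegrableOn (D.indicator fun _ => b) E μ := (integrableOn_const hE_fin).indicator hD
  refine (integral_mono_ae hf (hconst.add hind) ((ae_restrict_iff' hE).mpr hle)).trans_eq ?_
  simp only [Pi.add_apply]
  rw [integral_add hconst hind, setIntegral_indicator hD, inter_eq_right.mpr hDE,
    setIntegral_const, setIntegral_const, smul_eq_mul, smul_eq_mul, mul_comm a, mul_comm b]

theorem exists_pos_sqrt_mul_le (b : ℝ) {ε : ℝ} (hε : 0 < ε) : ∃ τ > 0, √τ * b ≤ ε := by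
  have h : Tendsto (fun τ => √τ * b) (𝓝[>] 0) (𝓝 0) := by
    simpa using ((Real.continuous_sqrt.tendsto 0).mul_const b).mono_left nhdsWithin_le_nhds
  exact (eventually_mem_nhdsWithin.and (h.eventually_le_const hε)).exists

namespace ProjUnitaryRep

section TraceEstimate

variable {G H : Type*} [Group G] [TopologicalSpace G] [MeasurableSpace G] {μ : Measure G}
  [NormedAddCommGroup H] [InnerProductSpace ℂ H] {π : ProjUnitaryRep G H} {d : ℝ}
  {g : H} {R : H →L[ℂ] H} {Λ : Set G} {B : ℝ}

theorem sum_crossTerm_le_add_indicator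
    (hB : IsBesselBound (fun l : Λ => π (l : G) g) B)
    (hR : IsInverseFrameOperator (fun l : Λ => π (l : G) g) R) {C K : Set G} {τ : ℝ} {x y : G}
    (hτ : ∀ s : Finset Λ, (∀ l ∈ s, (l : G) ∉ x • C) → ∑ l ∈ s, ‖π.coeff g g (x⁻¹ * l)‖ ^ 2 ≤ τ)
    {F : Finset Λ} (hF : (F : Set Λ) = (↑) ⁻¹' (y • K)) (hx : x ∈ y • (K * C)) :
    ∑ l ∈ F, crossTerm R (π (l : G) g) (π x g) ≤ ‖g‖ ^ 2 + √τ * (√B * (‖R‖ * ‖g‖)) +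
      (y • ((K * C) ∩ (Kᶜ * C⁻¹))).indicator (fun _ => B * ‖R‖ * ‖g‖ ^ 2) x := by
  have := hB.nonneg
  by_cases hxD : x ∈ y • ((K * C) ∩ (Kᶜ * C⁻¹))
  · rw [indicator_of_mem hxD]
    refine (hB.sum_crossTerm_le F (π x g)).trans ?_
    rw [LinearIsometryEquiv.norm_map]
    exact le_add_of_nonneg_left (by positivity)
  · rw [indicator_of_notMem hxD, add_zero, ← LinearIsometryEquiv.norm_map (π x) g]
    refine hR.sum_crossTerm_le hB fun s hs => ?_
    have hx_notMem : x ∉ y • (Kᶜ * C⁻¹) := fun hx' => hxD (smul_set_inter.superset ⟨hx, hx'⟩)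
    have hs_far : ∀ l ∈ s, (l : G) ∉ x • C := fun l hl =>
      notMem_smul_of_notMem_compl_mul hx_notMem fun hlK =>
        Finset.disjoint_left.mp hs hl (Finset.mem_coe.mp (hF ▸ hlK))
    refine le_trans (Finset.sum_le_sum fun l _ => ?_) (hτ s hs_far)
    rw [← norm_coeff_map, coeff, norm_inner_symm, norm_inner_symm]

variable [IsTopologicalGroup G] [BorelSpace G] [T2Space G] [μ.IsMulLeftInvariant]
  [IsFiniteMeasureOnCompacts μ]

theorem IsFormalDegree.sum_reApplyInnerSelf_le (hd : π.IsFormalDegree μ d)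
    (hB : IsBesselBound (fun l : Λ => π (l : G) g) B)
    (hR : IsInverseFrameOperator (fun l : Λ => π (l : G) g) R) {C K : Set G} (hC : IsCompact C)
    (hK : IsCompact K) {τ : ℝ} (hτ : ∫ x in Cᶜ, ‖π.coeff g g x‖ ^ 2 ∂μ ≤ τ)
    (hτ_sum : ∀ᵐ x ∂μ, ∀ s : Finset Λ, (∀ l ∈ s, (l : G) ∉ x • C) →
      ∑ l ∈ s, ‖π.coeff g g (x⁻¹ * l)‖ ^ 2 ≤ τ)
    {y : G} {F : Finset Λ} (hF : (F : Set Λ) = (↑) ⁻¹' (y • K)) :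
    d⁻¹ * ‖g‖ ^ 2 * ∑ l ∈ F, R.reApplyInnerSelf (π (l : G) g) ≤
      (‖g‖ ^ 2 + √τ * (√B * (‖R‖ * ‖g‖))) * μ.real (K * C) +
      B * ‖R‖ * ‖g‖ ^ 2 * μ.real ((K * C) ∩ (Kᶜ * C⁻¹)) +
      F.card * (√τ * (√d⁻¹ * (‖R‖ * ‖g‖ ^ 2))) := by
  set E := y • (K * C)
  have hE : IsCompact E := (hK.mul hC).smul y
  have hD : MeasurableSet (y • ((K * C) ∩ (Kᶜ * C⁻¹))) :=
    ((hK.mul hC).measurableSet.inter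
      hK.isClosed.isOpen_compl.mul_right.measurableSet).const_smul y
  have hint (l : Λ) : IntegrableOn (fun x => crossTerm R (π (l : G) g) (π x g)) E μ :=
    (hd.integrable_crossTerm hR.isSymmetric _).integrableOn
  have hmass : ∫ x in E, ∑ l ∈ F, crossTerm R (π (l : G) g) (π x g) ∂μ ≤
      (‖g‖ ^ 2 + √τ * (√B * (‖R‖ * ‖g‖))) * μ.real (K * C) +
        B * ‖R‖ * ‖g‖ ^ 2 * μ.real ((K * C) ∩ (Kᶜ * C⁻¹)) := by
    have h := setIntegral_le_of_le_add_indicator hD hE.measurableSet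
      (smul_set_mono inter_subset_left) hE.measure_ne_top
      (integrable_finsetSum F fun l _ => hint l)
      (hτ_sum.mono fun x hx => sum_crossTerm_le_add_indicator hB hR hx hF)
    simpa only [E, measureReal_def, measure_smul] using h
  have hterm : ∀ l ∈ F, d⁻¹ * ‖g‖ ^ 2 * R.reApplyInnerSelf (π (l : G) g) ≤
      ∫ x in E, crossTerm R (π (l : G) g) (π x g) ∂μ +
        √τ * (√d⁻¹ * (‖R‖ * ‖g‖ ^ 2)) := fun l hl => by
    have hlE : (l : G) • C ⊆ E := by
      obtain ⟨k, hk, hkl⟩ : (l : G) ∈ y • K := hF.subset hl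
      rw [← hkl]
      change (y * k) • C ⊆ y • (K * C)
      rw [← smul_smul]
      exact smul_set_mono (smul_set_subset_mul hk)
    refine (hd.reApplyInnerSelf_le_setIntegral_crossTerm hR.isSymmetric
      hE.measurableSet hlE).trans ?_
    gcongr
  rw [integral_finsetSum _ fun l _ => hint l] at hmass
  rw [Finset.mul_sum]
  refine (Finset.sum_le_sum hterm).trans ?_
  rw [Finset.sum_add_distrib, Finset.sum_const, nsmul_eq_mul]
  gcongr

end TraceEstimate

section Tails

variable {G H : Type*} [Group G] [TopologicalSpace G] [SigmaCompactSpace G] [T2Space G]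
  [MeasurableSpace G] [BorelSpace G] {μ : Measure G}
  [NormedAddCommGroup H] [InnerProductSpace ℂ H] {π : ProjUnitaryRep G H} {d : ℝ}

theorem IsFormalDegree.exists_isCompact_setIntegral_compl_le (hd : π.IsFormalDegree μ d) (g : H)
    {τ : ℝ} (hτ : 0 < τ) : ∃ C : Set G, IsCompact C ∧ ∫ x in Cᶜ, ‖π.coeff g g x‖ ^ 2 ∂μ ≤ τ := by
  have hint := hd.integrable_norm_coeff_sq g g
  have hnonneg (ν : Measure G) : 0 ≤ᵐ[ν] fun x => ‖π.coeff g g x‖ ^ 2 :=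
    .of_forall fun x => sq_nonneg _
  obtain ⟨C, hC, hle⟩ := exists_isCompact_setLIntegral_compl_le hint.lintegral_lt_top.ne
    (ENNReal.ofReal_pos.mpr hτ).ne'
  rw [← ofReal_integral_eq_lintegral_ofReal hint.integrableOn (hnonneg _)] at hle
  exact ⟨C, hC, (ENNReal.ofReal_le_ofReal_iff hτ.le).mp hle⟩

end Tails

section UniformTraceEstimate

variable {G H : Type*} [Group G] [TopologicalSpace G] [IsTopologicalGroup G]
  [LocallyCompactSpace G] [T2Space G] [SecondCountableTopology G]
  [MeasurableSpace G] [BorelSpace G] {μ : Measure G} [IsFiniteMeasureOnCompacts μ] [SFinite μ]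
  [μ.IsMulLeftInvariant] [μ.IsInvInvariant]
  [NormedAddCommGroup H] [InnerProductSpace ℂ H] {π : ProjUnitaryRep G H} {d : ℝ}
  {g : H} {R : H →L[ℂ] H} {Λ Q : Set G} {B : ℝ}

theorem IsFormalDegree.exists_isCompact_tails_le (hd : π.IsFormalDegree μ d)
    (hQ : IsCompact Q) (hQ_ne_zero : μ Q ≠ 0) (hgQ : g ∈ π.B2 μ Q)
    (hΛ : IsRelativelySeparated Λ) {τ : ℝ} (hτ : 0 < τ) :
    ∃ C : Set G, IsCompact C ∧ C⁻¹ = C ∧ C.Nonempty ∧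
      ∫ x in Cᶜ, ‖π.coeff g g x‖ ^ 2 ∂μ ≤ τ ∧
      ∀ᵐ x ∂μ, ∀ s : Finset Λ, (∀ l ∈ s, (l : G) ∉ x • C) →
        ∑ l ∈ s, ‖π.coeff g g (x⁻¹ * l)‖ ^ 2 ≤ τ := by
  obtain ⟨C₁, hC₁, hC₁τ⟩ := hd.exists_isCompact_setIntegral_compl_le g hτ
  obtain ⟨C₂, hC₂, hC₂τ⟩ := MemAmalgam.exists_isCompact_tail_le hQ hQ_ne_zero
    (π.stronglyMeasurable_coeff g g).measurable hgQ hΛ hτ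
  set C₀ := insert 1 (C₁ ∪ C₂)
  have hC₀ : IsCompact C₀ := (hC₁.union hC₂).insert 1
  have hC₁C : C₁ ⊆ C₀ ∪ C₀⁻¹ := fun x hx => .inl (.inr (.inl hx))
  have hC₂C : C₂ ⊆ C₀ ∪ C₀⁻¹ := fun x hx => .inl (.inr (.inr hx))
  refine ⟨C₀ ∪ C₀⁻¹, hC₀.union hC₀.inv, by rw [union_inv, inv_inv, union_comm],
    ⟨1, .inl (.inl rfl)⟩, ?_, ?_⟩
  · exact (setIntegral_mono_set (hd.integrable_norm_coeff_sq g g).integrableOn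
      (.of_forall fun x => sq_nonneg _) (compl_subset_compl.mpr hC₁C).eventuallyLE).trans hC₁τ
  · exact hC₂τ.mono fun x hx s hs => hx s fun l hl hlC => hs l hl (smul_set_mono hC₂C hlC)

theorem IsFormalDegree.exists_isCompact_forall_sum_reApplyInnerSelf_le
    (hd : π.IsFormalDegree μ d) (hg : g ≠ 0) (hQ : IsCompact Q) (hQ_ne_zero : μ Q ≠ 0)
    (hgQ : g ∈ π.B2 μ Q) (hΛ : IsRelativelySeparated Λ)
    (hB : IsBesselBound (fun l : Λ => π (l : G) g) B)
    (hR : IsInverseFrameOperator (fun l : Λ => π (l : G) g) R) {ε : ℝ} (hε : 0 < ε) :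
    ∃ C : Set G, IsCompact C ∧ C.Nonempty ∧ ∀ (K : Set G) (y : G) (F : Finset Λ),
      IsCompact K → (F : Set Λ) = (↑) ⁻¹' (y • K) →
        ∑ l ∈ F, R.reApplyInnerSelf (π (l : G) g) ≤ (d + ε) * μ.real (K * C) +
          d * B * ‖R‖ * μ.real ((K * C) ∩ (Kᶜ * C)) + ε * F.card := by
  have hd_pos := hd.1
  set c := d⁻¹ * ‖g‖ ^ 2
  have hc : 0 < c := by positivity
  have hcd : c * d = ‖g‖ ^ 2 := by simp only [c]; field_simp
  set b₁ := √B * (‖R‖ * ‖g‖)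
  set b₂ := √d⁻¹ * (‖R‖ * ‖g‖ ^ 2)
  obtain ⟨τ, hτ, hτ_le⟩ := exists_pos_sqrt_mul_le (max b₁ b₂) (mul_pos hc hε)
  have hb₁ : √τ * b₁ ≤ c * ε := by grw [← hτ_le, ← le_max_left]
  have hb₂ : √τ * b₂ ≤ c * ε := by grw [← hτ_le, ← le_max_right]
  obtain ⟨C, hC, hC_inv, hC_nonempty, hCτ, hCτ_sum⟩ :=
    hd.exists_isCompact_tails_le hQ hQ_ne_zero hgQ hΛ hτ
  refine ⟨C, hC, hC_nonempty, fun K y F hK hF => le_of_mul_le_mul_left ?_ hc⟩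
  set boundary := (K * C) ∩ (Kᶜ * C)
  calc c * ∑ l ∈ F, R.reApplyInnerSelf (π (l : G) g)
      ≤ (‖g‖ ^ 2 + √τ * b₁) * μ.real (K * C) + B * ‖R‖ * ‖g‖ ^ 2 * μ.real boundary +
          F.card * (√τ * b₂) := by
        simpa only [hC_inv] using hd.sum_reApplyInnerSelf_le hB hR hC hK hCτ hCτ_sum hF
    _ ≤ (‖g‖ ^ 2 + c * ε) * μ.real (K * C) + B * ‖R‖ * ‖g‖ ^ 2 * μ.real boundary +
          F.card * (c * ε) := by gcongr
    _ = c * ((d + ε) * μ.real (K * C) + d * B * ‖R‖ * μ.real boundary + ε * F.card) := by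
        rw [← hcd]
        ring

end UniformTraceEstimate

end ProjUnitaryRep

/-! ### Følner sequences and density -/

section Folner

variable {G : Type*} [Group G] [TopologicalSpace G] [MeasurableSpace G] {μ : Measure G}
  [IsFiniteMeasureOnCompacts μ] {K : ℕ → Set G}

theorem IsFolnerSeq.eventually_measureReal_le (hK : IsFolnerSeq μ K) {S : ℕ → Set G}
    (hS : Tendsto (fun n => μ (S n) / μ (K n)) atTop (𝓝 0)) {a : ℝ} (ha : 0 < a) :
    ∀ᶠ n in atTop, μ.real (S n) ≤ a * μ.real (K n) := by
  filter_upwards [hS.eventually_le_const (ENNReal.ofReal_pos.mpr ha)] with n hn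
  have hKn : μ (K n) ≠ ∞ := (hK.isCompact n).measure_ne_top
  rw [ENNReal.div_le_iff (hK.measure_ne_zero n) hKn] at hn
  have h := ENNReal.toReal_mono (ENNReal.mul_ne_top ENNReal.ofReal_ne_top hKn) hn
  rwa [ENNReal.toReal_mul, ENNReal.toReal_ofReal ha.le] at h

variable [IsTopologicalGroup G]

theorem IsFolnerSeq.eventually_measureReal_mul_le (hK : IsFolnerSeq μ K) {C : Set G}
    (hC : IsCompact C) (hC_nonempty : C.Nonempty) {a : ℝ} (ha : 0 < a) :
    ∀ᶠ n in atTop, μ.real (K n * C) ≤ (1 + a) * μ.real (K n) := by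
  filter_upwards [hK.eventually_measureReal_le (hK.tendsto_symmDiff C hC hC_nonempty) ha] with n hn
  have hsub : symmDiff (K n * C) (K n) ⊆ (K n * C) ∪ K n := symmDiff_le_sup
  have hfin : μ (symmDiff (K n * C) (K n)) ≠ ∞ :=
    measure_ne_top_of_subset hsub (((hK.isCompact n).mul hC).union (hK.isCompact n)).measure_ne_top
  calc μ.real (K n * C) ≤ μ.real (K n ∪ symmDiff (K n * C) (K n)) :=
        measureReal_mono (fun x hx => (em (x ∈ K n)).imp_right fun hxK => .inl ⟨hx, hxK⟩)
          (measure_union_ne_top (hK.isCompact n).measure_ne_top hfin)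
    _ ≤ μ.real (K n) + μ.real (symmDiff (K n * C) (K n)) := measureReal_union_le _ _
    _ ≤ (1 + a) * μ.real (K n) := by linarith

end Folner

section FolnerGrowth

variable {G : Type*} [Group G] [TopologicalSpace G] [IsTopologicalGroup G]
  [WeaklyLocallyCompactSpace G] [NoncompactSpace G] [MeasurableSpace G] [BorelSpace G]
  {μ : Measure G} [μ.Regular] [μ.IsOpenPosMeasure] [μ.IsMulLeftInvariant] {K : ℕ → Set G}

theorem IsFolnerSeq.tendsto_measureReal_atTop (hK : IsFolnerSeq μ K) :
    Tendsto (fun n => μ.real (K n)) atTop atTop := by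
  refine tendsto_atTop.mpr fun r => ?_
  obtain ⟨C, -, hC, hrC⟩ : ∃ C ⊆ univ, IsCompact C ∧ ENNReal.ofReal (2 * |r|) < μ C :=
    isOpen_univ.exists_lt_isCompact (by
      rw [measure_univ_of_isMulLeftInvariant]
      exact ENNReal.ofReal_lt_top)
  have hC_nonempty : C.Nonempty := nonempty_of_measure_ne_zero hrC.ne_bot
  filter_upwards [hK.eventually_measureReal_mul_le hC hC_nonempty one_pos] with n hn
  obtain ⟨k, hk⟩ := nonempty_of_measure_ne_zero (hK.measure_ne_zero n)
  have hle : μ.real C ≤ μ.real (K n * C) := by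
    rw [measureReal_def, ← measure_smul μ k C]
    exact measureReal_mono (smul_set_subset_mul hk) ((hK.isCompact n).mul hC).measure_ne_top
  rw [ENNReal.ofReal_lt_iff_lt_toReal (by positivity) hC.measure_ne_top, ← measureReal_def] at hrC
  linarith [le_abs_self r]

end FolnerGrowth

section Density

theorem mul_card_sub_card_le_sum {ι : Type*} {p : ι → ℝ} (hp : ∀ i, 0 ≤ p i) {α : ℝ} (hα : 0 ≤ α)
    (hfin : {i | p i ≤ α}.Finite) (F : Finset ι) :
    α * (F.card - hfin.toFinset.card) ≤ ∑ i ∈ F, p i := by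
  classical
  have hcard : (F.card : ℝ) - hfin.toFinset.card ≤ (F \ hfin.toFinset).card := by
    rw [sub_le_iff_le_add]
    exact_mod_cast Finset.card_le_card_sdiff_add_card
  calc α * (F.card - hfin.toFinset.card) ≤ (F \ hfin.toFinset).card • α := by
        rw [nsmul_eq_mul, mul_comm]
        gcongr
    _ ≤ ∑ i ∈ F \ hfin.toFinset, p i := Finset.card_nsmul_le_sum _ _ _ fun i hi => by
        have h := (Finset.mem_sdiff.mp hi).2
        rw [Finite.mem_toFinset] at h
        exact (not_le.mp h).le
    _ ≤ ∑ i ∈ F, p i :=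
        Finset.sum_le_sum_of_subset_of_nonneg Finset.sdiff_subset fun i _ _ => hp i

variable {G : Type*} [Group G] [TopologicalSpace G] [MeasurableSpace G] {μ : Measure G}
  [IsFiniteMeasureOnCompacts μ] {K : ℕ → Set G} {Λ : Set G}

theorem IsFolnerSeq.frequently_exists_mul_measureReal_lt_card (hK : IsFolnerSeq μ K)
    (hΛ : IsRelativelySeparated Λ) {D : NNReal} (hD : D < upperBeurlingDensity μ K Λ) :
    ∃ᶠ n in atTop, ∃ (y : G) (F : Finset Λ), (F : Set Λ) = (↑) ⁻¹' (y • K n) ∧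
      D * μ.real (K n) < F.card := by
  refine (frequently_lt_of_lt_limsup (by isBoundedDefault) hD).mono fun n hn => ?_
  obtain ⟨y, hy⟩ := lt_iSup_iff.mp hn
  have hfin := hΛ.finite_preimage_smul (hK.isCompact n) y
  refine ⟨y, hfin.toFinset, hfin.coe_toFinset, ?_⟩
  have hKn : μ (K n) ≠ ∞ := (hK.isCompact n).measure_ne_top
  rw [← Subtype.image_preimage_coe, Subtype.val_injective.encard_image,
    hfin.encard_eq_coe_toFinset_card,
    ENNReal.lt_div_iff_mul_lt (.inl (hK.measure_ne_zero n)) (.inl hKn)] at hy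
  simpa [measureReal_def] using
    (ENNReal.toReal_lt_toReal (ENNReal.mul_ne_top ENNReal.coe_ne_top hKn) (by simp)).mpr hy

theorem IsFolnerSeq.exists_infinite_setOf_le (hK : IsFolnerSeq μ K)
    (hK_tendsto : Tendsto (fun n => μ.real (K n)) atTop atTop) (hΛ : IsRelativelySeparated Λ)
    {d : ℝ} (hd : 0 ≤ d) (hdensity : ENNReal.ofReal d < upperBeurlingDensity μ K Λ)
    {p : Λ → ℝ} (hp : ∀ l, 0 ≤ p l)
    (hsum : ∀ ε > 0, ∀ᶠ n in atTop, ∀ (y : G) (F : Finset Λ), (F : Set Λ) = (↑) ⁻¹' (y • K n) →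
      ∑ l ∈ F, p l ≤ (d + ε) * μ.real (K n) + ε * F.card) :
    ∃ α < 1, {l | p l ≤ α}.Infinite := by
  obtain ⟨D, hdD, hD⟩ := ENNReal.lt_iff_exists_nnreal_btwn.mp hdensity
  replace hdD : d < D := by
    rwa [← ENNReal.ofReal_coe_nnreal, ENNReal.ofReal_lt_ofReal_iff_of_nonneg hd] at hdD
  set ε := (D - d) / (2 * (1 + D))
  have hε : 0 < ε := div_pos (sub_pos.mpr hdD) (by positivity)
  have hεD : 2 * ε * (1 + D) = D - d := by simp only [ε]; field_simp
  have hε_lt : 2 * ε < 1 := by nlinarith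
  refine ⟨1 - ε, by linarith, fun hfin => ?_⟩
  set N := (hfin.toFinset.card : ℝ)
  obtain ⟨n, ⟨y, F, hF, hFD⟩, hN, hn⟩ :=
    ((hK.frequently_exists_mul_measureReal_lt_card hΛ hD).and_eventually
      ((hK_tendsto.eventually_ge_atTop (N / ε)).and (hsum ε hε))).exists
  set m := μ.real (K n)
  replace hN : N ≤ ε * m := by rwa [div_le_iff₀' hε] at hN
  have hlow : (1 - ε) * (F.card - N) ≤ (d + ε) * m + ε * F.card :=
    (mul_card_sub_card_le_sum hp (by linarith) hfin F).trans (hn y F hF)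
  have hN_nonneg : 0 ≤ N := Nat.cast_nonneg _
  have hcontra : (d + 2 * ε) * m < (d + 2 * ε) * m := calc
    (d + 2 * ε) * m = (1 - 2 * ε) * (D * m) := by linear_combination m * hεD
    _ < (1 - 2 * ε) * F.card := mul_lt_mul_of_pos_left hFD (by linarith)
    _ ≤ (d + ε) * m + (1 - ε) * N := by linarith
    _ ≤ (d + ε) * m + 1 * (ε * m) := by gcongr; linarith
    _ = (d + 2 * ε) * m := by ring
  exact hcontra.false

end Density

namespace ProjUnitaryRep

variable {G H : Type*} [Group G] [TopologicalSpace G] [IsTopologicalGroup G]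
  [LocallyCompactSpace G] [T2Space G] [SecondCountableTopology G]
  [MeasurableSpace G] [BorelSpace G] {μ : Measure G} [IsFiniteMeasureOnCompacts μ] [SFinite μ]
  [μ.IsMulLeftInvariant] [μ.IsInvInvariant]
  [NormedAddCommGroup H] [InnerProductSpace ℂ H] {π : ProjUnitaryRep G H} {d : ℝ}
  {g : H} {R : H →L[ℂ] H} {Λ Q : Set G} {B : ℝ} {K : ℕ → Set G}

theorem IsFormalDegree.eventually_sum_reApplyInnerSelf_le
    (hd : π.IsFormalDegree μ d) (hg : g ≠ 0) (hQ : IsCompact Q) (hQ_ne_zero : μ Q ≠ 0)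
    (hgQ : g ∈ π.B2 μ Q) (hK : IsStrongFolnerSeq μ K) (hΛ : IsRelativelySeparated Λ)
    (hB : IsBesselBound (fun l : Λ => π (l : G) g) B)
    (hR : IsInverseFrameOperator (fun l : Λ => π (l : G) g) R) {ε : ℝ} (hε : 0 < ε) :
    ∀ᶠ n in atTop, ∀ (y : G) (F : Finset Λ), (F : Set Λ) = (↑) ⁻¹' (y • K n) →
      ∑ l ∈ F, R.reApplyInnerSelf (π (l : G) g) ≤ (d + ε) * μ.real (K n) + ε * F.card := by
  have hd_pos := hd.1
  have := hB.nonneg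
  obtain ⟨C, hC, hC_nonempty, hle⟩ := hd.exists_isCompact_forall_sum_reApplyInnerSelf_le
    hg hQ hQ_ne_zero hgQ hΛ hB hR (half_pos hε)
  set b := d * B * ‖R‖
  have hb : 0 ≤ b := by positivity
  set a := ε / 2 / (d + ε / 2 + b)
  have ha : a * (d + ε / 2 + b) = ε / 2 := div_mul_cancel₀ _ (by positivity)
  have ha_pos : 0 < a := by positivity
  filter_upwards [hK.eventually_measureReal_mul_le hC hC_nonempty ha_pos,
    hK.eventually_measureReal_le (hK.tendsto_boundary C hC) ha_pos] with n hn_mul hn_boundary y F hF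
  calc ∑ l ∈ F, R.reApplyInnerSelf (π (l : G) g)
      ≤ (d + ε / 2) * μ.real (K n * C) + b * μ.real ((K n * C) ∩ ((K n)ᶜ * C)) +
          ε / 2 * F.card := hle (K n) y F (hK.isCompact n) hF
    _ ≤ (d + ε / 2) * ((1 + a) * μ.real (K n)) + b * (a * μ.real (K n)) + ε * F.card := by
        gcongr
        exact half_le_self hε.le
    _ = (d + ε) * μ.real (K n) + ε * F.card := by linear_combination μ.real (K n) * ha

end ProjUnitaryRep

end CoherentFrame

open CoherentFrame in
theorem theorem4p2_general
    {G : Type*} [Group G] [TopologicalSpace G] [IsTopologicalGroup G] [LocallyCompactSpace G]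
    [T2Space G] [SecondCountableTopology G] [NoncompactSpace G]
    [MeasurableSpace G] [BorelSpace G]
    (μ : Measure G) [μ.IsHaarMeasure] [μ.IsMulRightInvariant]
    {H : Type*} [NormedAddCommGroup H] [InnerProductSpace ℂ H] [CompleteSpace H] [Nontrivial H]
    (Q : Set G) (hQ : IsCompact Q) (hQ_ne_zero : μ Q ≠ 0)
    (K : ℕ → Set G) (hK : IsStrongFolnerSeq μ K)
    (π : ProjUnitaryRep G H) (d : ℝ) (hd : π.IsFormalDegree μ d)
    (Λ : Set G) (g : H) (hgQ : g ∈ π.B2 μ Q)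
    (hframe : IsFrame (fun l : Λ => π (l : G) g))
    (hdensity : ENNReal.ofReal d < upperBeurlingDensity μ K Λ) :
    ∃ Γ : Set G, Γ ⊆ Λ ∧ Γ.Infinite ∧ IsFrame (fun l : (Λ \ Γ : Set G) => π (l : G) g) := by
  have := isInvInvariant_of_isMulRightInvariant μ
  have hg : g ≠ 0 := by
    obtain ⟨l, hl⟩ := hframe.exists_ne_zero
    rintro rfl
    exact hl (map_zero _)
  obtain ⟨B, hB⟩ := hframe.exists_isBesselBound
  obtain ⟨R, hR⟩ := hframe.exists_isInverseFrameOperator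
  have hΛ : IsRelativelySeparated Λ :=
    ProjUnitaryRep.isRelativelySeparated_of_isBesselBound (hd.not_ae_coeff_self_eq_zero hg) hB
  have hR_nonneg (f : H) : 0 ≤ R.reApplyInnerSelf f := by
    rw [← norm_analysisOperator_map_sq hB hR]
    positivity
  obtain ⟨α, hα, hinf⟩ := hK.exists_infinite_setOf_le hK.tendsto_measureReal_atTop hΛ hd.1.le
    hdensity (fun l => hR_nonneg (π (l : G) g)) fun ε hε =>
      hd.eventually_sum_reApplyInnerSelf_le hg hQ hQ_ne_zero hgQ hK hΛ hB hR hε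
  obtain ⟨Γ, hΓ, hΓ_frame⟩ := hframe.exists_infinite_compl hR hα hinf
  exact ⟨(↑) '' Γ, Subtype.coe_image_subset Λ Γ, hΓ.image Subtype.val_injective.injOn,
    hΓ_frame.diff_image_coe (u := fun x => π x g)⟩

theorem theorem4p2
    {G : Type*} [Group G] [TopologicalSpace G] [IsTopologicalGroup G] [LocallyCompactSpace G]
    [T2Space G] [SecondCountableTopology G] [NoncompactSpace G]
    [MeasurableSpace G] [BorelSpace G]
    (μ : Measure G) [μ.IsHaarMeasure] [μ.IsMulRightInvariant]
    {H : Type*} [NormedAddCommGroup H] [InnerProductSpace ℂ H] [CompleteSpace H]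
    (Q : Set G) (hQ_compact : IsCompact Q) (hQ_nhds : Q ∈ 𝓝 (1 : G)) (hQ_symm : Q⁻¹ = Q)
    (K : ℕ → Set G) (hK : CoherentFrame.IsStrongFolnerSeq μ K)
    (π : CoherentFrame.ProjUnitaryRep G H) (hπ : π.IsDiscreteSeries μ)
    (Λ : Set G) (hΛ : DiscreteTopology Λ)
    (g : H) (hg : g ∈ π.B2 μ Q)
    (hframe : CoherentFrame.IsFrame (fun l : Λ => π (l : G) g))
    (hdensity : ENNReal.ofReal (π.formalDegree μ) < CoherentFrame.upperBeurlingDensity μ K Λ) :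
    ∃ Γ : Set G, Γ ⊆ Λ ∧ Γ.Infinite ∧
      CoherentFrame.IsFrame (fun l : (Λ \ Γ : Set G) => π (l : G) g) := by
  have := hπ.nontrivial
  have := CoherentFrame.isInvInvariant_of_isMulRightInvariant μ
  exact theorem4p2_general μ Q hQ_compact (Measure.measure_pos_of_mem_nhds μ hQ_nhds).ne' K hK π _
    hπ.isFormalDegree_formalDegree Λ g hg hframe hdensity
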